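/- **Setting.** Let $M$ be a smooth (Hausdorff, finite-dimensional, boundaryless) manifold and $\nabla$ a smooth affine connection on $M$, with torsion $T(X,Y)=\nabla_XY-\nabla_YX-[X,Y]$ and curvature $R(X,Y)Z=\nabla_X\nabla_YZ-\nabla_Y\nabla_XZ-\nabla_{[X,Y]}Z$. Let $p:TN\to N$ denote the projection of a tangent bundle, $T^2M=T(TM)$, $T^3M=T(T^2M)$, and let $T^2_xM$, $T^3_xM$ be the fibres over $x\in M$ of the composed projections to $M$. For a map $f$, $f_*$ is its differential and $f_{**}=(f_*)_*$. *Canonical involution and difference.* $\kappa$ is the canonical involution of $T^3M=T^2(TM)$, that is, the one of $T^2N=T(TN)$ for $N=TM$, which in the coordinates $(n,U,V,\mathcal W)$ of $T^2N$ induced by local coordinates of $N$ is $(n,U,V,\mathcal W)\mapsto(n,V,U,\mathcal W)$. For $\mathfrak X\in T^3_yM$ and $V\in T_yM$, put $Z=p(\mathfrak X)\in T^2M$; let $\mathfrak X\dotplus V\in T^3M$ be the sum, in $T_Z(T^2M)$, of $\mathfrak X$ and of the vertical lift at $Z$ of the vertical lift of $V$ at $p(Z)\in TM$ (the vertical lift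 at $w\in T_nN$ of $v\in T_nN$ being the velocity at $t=0$ of $t\mapsto w+tv$). For $\mathfrak X^1,\mathfrak X^2\in T^3_yM$ with the same image under $p\times p_*\times p_{**}$, $\Pi(\mathfrak X^1,\mathfrak X^2)\in T_yM$ is the vector $V$ with $\mathfrak X^1=\mathfrak X^2\dotplus V$. *Jets.* A 1-jet $\xi$ with source $x$ and target $y$ is a linear isomorphism $\xi:T_xM\to T_yM$; these form the Lie groupoid $\mathcal B^{(1)}=\mathcal B^{(1)}(\mathrm{Pair}(M))$. A local bisection $b$ of $\mathcal B^{(1)}$ is a smooth family of 1-jets $b(x')$ with source $x'$, $x'$ in an open set $U\subset M$, whose target map $b^0$ is a diffeomorphism of $U$ onto an open set. A $(1,1)$-jet with source $x$ is the 1-jet $j^1_xb$ at $x$ of a local bisection $b$ of $\mathcal B^{(1)}$ defined near $x$; it acts on $T^2_xM$ by $j^1_xb\cdot\frac{d}{dt}X_t=\frac{d}{dt}(b(p(X_t))X_t)$, and is determined by this action. Likewise a $(1,1,1)$-jet with source $x$ is the 1-jet at $x$ of a local bisection $\beta$ of the groupoid of $(1,1)$-jets; it acts on $T^3_xM$ by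 $j^1_x\beta\cdot\frac{d}{dt}\mathcal X_t=\frac{d}{dt}(\beta\cdot\mathcal X_t)$ and is determined by this action. For a $(1,1,1)$-jet $J$, $\kappa(J)$ is defined by its action $\kappa(J)\cdot\mathfrak X=\kappa(J\cdot\kappa(\mathfrak X))$, and $J$ is $\kappa$-invariant if $\kappa(J)=J$. *Affine extensions.* A $(1,1)$-jet $j^1_xb$ is affine if it is semi-holonomic, i.e. $b^0_{*x}=b(x)$, and preserves $\nabla$, i.e. $b(x)(\nabla_uY)=\nabla_{b(x)u}(bY)$ for all $u\in T_xM$ and all vector fields $Y$ near $x$, where $(bY)(b^0(x'))=b(x')Y(x')$. Let $S(\xi)$ denote the affine $(1,1)$-jet with first order part $\xi$ (i.e. $b(x)=\xi$), and $\mathbb S(\xi)$ the $(1,1,1)$-jet $j^1_x(S\circ a)$, where $a$ is a local bisection of $\mathcal B^{(1)}$ with $a(x)=\xi$ and $j^1_xa=S(\xi)$. A 1-jet $\xi$ with source $x$ preserves the torsion if $\xi(T(u,v))=T(\xi u,\xi v)$, and the curvature if $\xi(R(u,v)w)=R(\xi u,\xi v)\xi w$, for all $u,v,w\in T_xM$.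 **Proposition.** 1. For every $\xi\in\mathcal B^{(1)}$, $S(\xi)$ and $\mathbb S(\xi)$ exist and are unique. 2. Let $\xi\in\mathcal B^{(1)}$ have source $x$ and preserve the torsion. Then for all smooth vector fields $X,Y,Z$ on $M$, with $\mathfrak X=Z_{**}Y_{*}X_x\in T^3_xM$, the elements $\mathbb S(\xi)\cdot\mathfrak X$ and $\kappa(\mathbb S(\xi))\cdot\mathfrak X$ have the same image under $p\times p_*\times p_{**}$ and $$\Pi\big(\mathbb S(\xi)\cdot\mathfrak X,\ \kappa(\mathbb S(\xi))\cdot\mathfrak X\big)=\xi\big(R(X_x,Y_x)Z_x\big)-R(\xi X_x,\xi Y_x)\,\xi Z_x .$$ Moreover, $\mathbb S(\xi)$ is $\kappa$-invariant if and only if $\xi$ preserves the curvature. 3. Suppose that the torsion of $\nabla$ vanishes identically. Let $x\in M$, $a\in\mathbb R\setminus\{0,1,-1\}$, and let $m_a:T_xM\to T_xM$, $u\mapsto au$. Then for all smooth vector fields $X,Y,Z$ on $M$, with $\mathfrak X=Z_{**}Y_{*}X_x$, $$R(X_x,Y_x)Z_x=\frac1{a(1-a^2)}\,\Pi\big(\mathbb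 S(m_a)\cdot\mathfrak X,\ \kappa(\mathbb S(m_a))\cdot\mathfrak X\big).$$ -/

import Mathlib

open scoped Manifold ContDiff Topology
open Bundle

noncomputable section

namespace AffineJets

/-! ### Second tangent bundle of a manifold: vertical lift and canonical involution

Everything in this section is for an arbitrary manifold `N`; it is used below both for `N = M`
and for `N = TM`. -/

section Second

variable {F : Type*} [NormedAddCommGroup F] [NormedSpace ℝ F]
  {H : Type*} [TopologicalSpace H] {I : ModelWithCorners ℝ F H}
  {N : Type*} [TopologicalSpace N] [ChartedSpace H N] [IsManifold I 1 N]

/-- The vertical lift of `v ∈ T_x N` at `w ∈ T_x N`: the velocity at `t = 0` of the curve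
`t ↦ w + t v` in `TN`, that is, the image of `v` under the derivative at `w` of the inclusion of
the fibre `T_x N` in `TN`. -/
def vlift (w : TangentBundle I N) (v : TangentSpace I w.proj) : TangentSpace I.tangent w :=
  mfderiv 𝓘(ℝ, F) I.tangent (fun u : F => (⟨w.proj, u⟩ : TangentBundle I N)) w.2 v

/-- The canonical involution of `T²N`. In the coordinates `(x, X, Y, 𝒳)` of `T²N` induced by local
coordinates of `N` it exchanges the two middle groups of coordinates. An element of Mathlib's
`T(TN)` is a triple of nested pairs `⟨⟨x, X⟩, (Y, 𝒳)⟩` in which `X`, `Y` and `𝒳` already are the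
coordinates with respect to the preferred chart of `N` at `x`: the preferred chart of `TN` at
`⟨x, X⟩` is the one induced by the preferred chart of `N` at `x`. -/
def kappa (𝒳 : TangentBundle I.tangent (TangentBundle I N)) :
    TangentBundle I.tangent (TangentBundle I N) :=
  ⟨⟨𝒳.proj.proj, (show F × F from 𝒳.2).1⟩,
    (show F × F from (show F from 𝒳.proj.2, (show F × F from 𝒳.2).2))⟩

end Second

variable {E : Type*} [NormedAddCommGroup E] [NormedSpace ℝ E]
  {M : Type*} [TopologicalSpace M] [ChartedSpace E M] [IsManifold 𝓘(ℝ, E) ∞ M]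

variable (E M) in
/-- The tangent bundle `TM`. -/
abbrev T1 := TangentBundle 𝓘(ℝ, E) M

variable (E M) in
/-- The second tangent bundle `T²M = T(TM)`. -/
abbrev T2 := TangentBundle 𝓘(ℝ, E).tangent (T1 E M)

variable (E M) in
/-- The third tangent bundle `T³M = T(T²M)`. -/
abbrev T3 := TangentBundle 𝓘(ℝ, E).tangent.tangent (T2 E M)

variable (E) in
/-- The fibre `T²_x M` of `p² : T²M → M`. -/
abbrev T2At (x : M) := {𝒳 : T2 E M // 𝒳.proj.proj = x}

variable (E) in
/-- The fibre `T³_x M` of `p³ : T³M → M`. -/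
abbrev T3At (x : M) := {𝔛 : T3 E M // 𝔛.proj.proj.proj = x}

/-- The parametrization `V ↦ A(V)` by `T_x M` of the fibre of
`p × p_* × p_** : T³M → T²M × T²M × T²M` through `𝔛 ∈ T³_x M`: with `Z = p(𝔛) ∈ T²M`,
the vector `V` is lifted vertically to `T_{p(Z)} TM`, then to `T_Z T²M`, and added to
`𝔛 ∈ T_Z T²M`. -/
def translate (𝔛 : T3 E M) (V : TangentSpace 𝓘(ℝ, E) 𝔛.proj.proj.proj) : T3 E M :=
  ⟨𝔛.proj, 𝔛.2 + vlift 𝔛.proj (vlift 𝔛.proj.proj V)⟩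

/-- `IsDiff 𝔛₁ 𝔛₂ V` says that `𝔛₁` and `𝔛₂` have the same image under `p × p_* × p_**` and that
`Π(𝔛₁, 𝔛₂) = V`, that is, `𝔛₁` is the translate of `𝔛₂` by `V`. -/
def IsDiff (𝔛₁ 𝔛₂ : T3 E M) (V : T1 E M) : Prop :=
  ∃ h : V.proj = 𝔛₂.proj.proj.proj, 𝔛₁ = translate 𝔛₂ (h ▸ V.2)

/-! ### Jets -/

variable (E) in
/-- The elements with source `x` of the groupoid `B⁽¹⁾(Pair(M))` of 1-jets of local
diffeomorphisms of `M`, that is, the linear isomorphisms from `T_x M` to some `T_y M`. -/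
structure Jet1 (x : M) where
  /-- The target. -/
  tgt : M
  /-- The isomorphism. -/
  map : TangentSpace 𝓘(ℝ, E) x ≃L[ℝ] TangentSpace 𝓘(ℝ, E) tgt

variable (E) in
/-- A local bisection `b` of `B⁽¹⁾(Pair(M))` defined near `x`. Only the values on `dom` matter.
Smoothness of `b` is smoothness of the bundle map `X ↦ b(p(X)) X` it induces on `TM`. -/
structure LocBis1 (x : M) where
  /-- The bisection. -/
  toFun : ∀ x' : M, Jet1 E x'
  /-- The domain. -/
  dom : Set M
  isOpen_dom : IsOpen dom
  mem_dom : x ∈ dom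
  smooth : ContMDiffOn 𝓘(ℝ, E).tangent 𝓘(ℝ, E).tangent ∞
    (fun X : T1 E M => (⟨(toFun X.proj).tgt, (toFun X.proj).map X.2⟩ : T1 E M))
    {X | X.proj ∈ dom}
  injOn : Set.InjOn (fun x' => (toFun x').tgt) dom
  localDiffeo : IsLocalDiffeomorphOn 𝓘(ℝ, E) 𝓘(ℝ, E) ∞ (fun x' => (toFun x').tgt) dom

namespace LocBis1

variable {x : M}

/-- The underlying local diffeomorphism `b⁰` of `M`. -/
def base (b : LocBis1 E x) (x' : M) : M := (b.toFun x').tgt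

/-- The action `X ↦ b(p(X)) X` of a local bisection on `TM`. -/
def act (b : LocBis1 E x) (X : T1 E M) : T1 E M :=
  ⟨(b.toFun X.proj).tgt, (b.toFun X.proj).map X.2⟩

/-- The action on `T²_x M` of the jet `j¹_x b`, that is, `d/dt X_t ↦ d/dt (b · X_t)`. -/
def jetAct (b : LocBis1 E x) (𝒳 : T2At E x) : T2 E M :=
  tangentMap 𝓘(ℝ, E).tangent 𝓘(ℝ, E).tangent b.act 𝒳.1

/-- `j¹_x b` is semi-holonomic: its two projections `p(j¹_x b) = b(x)` and
`p_*(j¹_x b) = j¹_x (b⁰)` on `B⁽¹⁾(Pair(M))` coincide. -/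
def Semiholonomic (b : LocBis1 E x) : Prop :=
  ∀ v : TangentSpace 𝓘(ℝ, E) x,
    mfderiv 𝓘(ℝ, E) 𝓘(ℝ, E) b.base x v = (b.toFun x).map v

/-- `j¹_x b` preserves the covariant derivative `∇` at `x`: `b(x)(∇_u Y) = ∇_{b(x)u} (bY)` for
all `u ∈ T_x M` and all vector fields `Y` near `x`; here `W = bY` is the vector field near
`b⁰(x)` with `W(b⁰(x')) = b(x') Y(x')`. -/
def PreservesCov (cov : CovariantDerivative 𝓘(ℝ, E) E (TangentSpace 𝓘(ℝ, E) : M → Type _))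
    (b : LocBis1 E x) : Prop :=
  ∀ Y W : Π x' : M, TangentSpace 𝓘(ℝ, E) x',
    ContMDiffAt 𝓘(ℝ, E) 𝓘(ℝ, E).tangent ∞ (fun x' => (⟨x', Y x'⟩ : T1 E M)) x →
    ContMDiffAt 𝓘(ℝ, E) 𝓘(ℝ, E).tangent ∞ (fun y' => (⟨y', W y'⟩ : T1 E M)) (b.toFun x).tgt →
    (∀ᶠ x' in 𝓝 x, W (b.toFun x').tgt = (b.toFun x').map (Y x')) →
    ∀ u : TangentSpace 𝓘(ℝ, E) x,
      (b.toFun x).map (cov Y x u) = cov W (b.toFun x).tgt ((b.toFun x).map u)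

end LocBis1

variable (E) in
/-- The `(1,1)`-jets with source `x`, that is, the 1-jets at `x` of local bisections of
`B⁽¹⁾(Pair(M))`. Two local bisections have the same 1-jet at `x` if and only if their derivatives
coincide over `T_x M`, that is, if and only if their jets act on `T²_x M` in the same way; thus a
`(1,1)`-jet is identified with its action. -/
@[ext]
structure Jet11 (x : M) where
  /-- The action `𝒳 ↦ ξ · 𝒳`. -/
  act : T2At E x → T2 E M
  exists_rep : ∃ b : LocBis1 E x, act = b.jetAct

/-- The target of a `(1,1)`-jet. -/
def Jet11.tgt {x : M} (j : Jet11 E x) : M :=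
  (j.act ⟨(⟨(⟨x, 0⟩ : T1 E M), 0⟩ : T2 E M), rfl⟩).proj.proj

variable (E) in
/-- A local bisection of `B⁽¹,¹⁾(Pair(M))` defined near `x`. Only the values on `dom` matter.
Smoothness is smoothness of the induced map `𝒳 ↦ b(p²(𝒳)) · 𝒳` on `T²M`. -/
structure LocBis11 (x : M) where
  /-- The bisection. -/
  toFun : ∀ x' : M, Jet11 E x'
  /-- The domain. -/
  dom : Set M
  isOpen_dom : IsOpen dom
  mem_dom : x ∈ dom
  smooth : ContMDiffOn 𝓘(ℝ, E).tangent.tangent 𝓘(ℝ, E).tangent.tangent ∞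
    (fun 𝒳 : T2 E M => (toFun 𝒳.proj.proj).act ⟨𝒳, rfl⟩) {𝒳 | 𝒳.proj.proj ∈ dom}
  injOn : Set.InjOn (fun x' => (toFun x').tgt) dom
  localDiffeo : IsLocalDiffeomorphOn 𝓘(ℝ, E) 𝓘(ℝ, E) ∞ (fun x' => (toFun x').tgt) dom

/-- The action `𝒳 ↦ b(p²(𝒳)) · 𝒳` of a local bisection of `B⁽¹,¹⁾(Pair(M))` on `T²M`. -/
def LocBis11.act {x : M} (b : LocBis11 E x) (𝒳 : T2 E M) : T2 E M :=
  (b.toFun 𝒳.proj.proj).act ⟨𝒳, rfl⟩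

/-- The action on `T³_x M` of the jet `j¹_x b`, that is, `d/dt 𝒳_t ↦ d/dt (b · 𝒳_t)`. -/
def LocBis11.jetAct {x : M} (b : LocBis11 E x) (𝔛 : T3At E x) : T3 E M :=
  tangentMap 𝓘(ℝ, E).tangent.tangent 𝓘(ℝ, E).tangent.tangent b.act 𝔛.1

variable (E) in
/-- The `(1,1,1)`-jets with source `x`, that is, the 1-jets at `x` of local bisections of
`B⁽¹,¹⁾(Pair(M))`, identified with their action on `T³_x M`. -/
@[ext]
structure Jet111 (x : M) where
  /-- The action `𝔛 ↦ ξ · 𝔛`. -/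
  act : T3At E x → T3 E M
  exists_rep : ∃ b : LocBis11 E x, act = b.jetAct

/-- The action on `T³_x M` of `κ(ξ)`, for a `(1,1,1)`-jet `ξ`: `κ(ξ) · 𝔛 = κ(ξ · κ(𝔛))`, where
`κ` is the canonical involution of `T³M = T²(TM)`. -/
def Jet111.kappaAct {x : M} (ξ : Jet111 E x) (𝔛 : T3At E x) : T3 E M :=
  kappa (ξ.act ⟨kappa 𝔛.1, 𝔛.2⟩)

/-! ### Affine jets -/

section Affine

variable (cov : CovariantDerivative 𝓘(ℝ, E) E (TangentSpace 𝓘(ℝ, E) : M → Type _))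

/-- `j = S(ξ)`: the `(1,1)`-jet `j` is affine, that is, semi-holonomic and preserving `∇`, and its
first order part is `ξ`. -/
def IsAffineExt {x : M} (ξ : Jet1 E x) (j : Jet11 E x) : Prop :=
  ∃ b : LocBis1 E x, j.act = b.jetAct ∧ b.toFun x = ξ ∧ b.Semiholonomic ∧ b.PreservesCov cov

/-- `J = 𝕊(ξ)`: the `(1,1,1)`-jet `J` is `j¹_x (S ∘ a)` for some local bisection `a` of
`B⁽¹⁾(Pair(M))` with `a(x) = ξ` and `j¹_x a = S(ξ)`. Here `j` is `S(ξ)` and `β` is `S ∘ a`. -/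
def IsAffineExt3 {x : M} (ξ : Jet1 E x) (J : Jet111 E x) : Prop :=
  ∃ a : LocBis1 E x, a.toFun x = ξ ∧
    (∃ j : Jet11 E x, IsAffineExt cov ξ j ∧ j.act = a.jetAct) ∧
    ∃ β : LocBis11 E x, (∀ᶠ x' in 𝓝 x, IsAffineExt cov (a.toFun x') (β.toFun x')) ∧
      J.act = β.jetAct

/-! ### Curvature -/

/-- The vector field `R(X, Y)Z = ∇_X ∇_Y Z - ∇_Y ∇_X Z - ∇_{[X, Y]} Z`. -/
def curvatureField (X Y Z : Π x : M, TangentSpace 𝓘(ℝ, E) x) (x : M) : TangentSpace 𝓘(ℝ, E) x :=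
  cov (fun z => cov Z z (Y z)) x (X x) - cov (fun z => cov Z z (X z)) x (Y x)
    - cov Z x (VectorField.mlieBracket 𝓘(ℝ, E) X Y x)

/-- The curvature tensor `R(u, v)w`, computed with vector fields, smooth near `x`, that extend
`u, v, w ∈ T_x M`. -/
def curvature (x : M) (u v w : TangentSpace 𝓘(ℝ, E) x) : TangentSpace 𝓘(ℝ, E) x :=
  curvatureField cov (FiberBundle.extend E u) (FiberBundle.extend E v) (FiberBundle.extend E w) x

/-- `ξ` preserves the curvature tensor. -/
def PreservesCurvature {x : M} (ξ : Jet1 E x) : Prop :=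
  ∀ u v w : TangentSpace 𝓘(ℝ, E) x,
    ξ.map (curvature cov x u v w) = curvature cov ξ.tgt (ξ.map u) (ξ.map v) (ξ.map w)

/-- `ξ` preserves the torsion tensor. -/
def PreservesTorsion [FiniteDimensional ℝ E] {x : M} (ξ : Jet1 E x) : Prop :=
  ∀ u v : TangentSpace 𝓘(ℝ, E) x,
    ξ.map (cov.torsion x u v) = cov.torsion ξ.tgt (ξ.map u) (ξ.map v)

end Affine

variable (E) in
/-- The homothety `m_a : T_x M → T_x M`, for `a ≠ 0`, as an element of `B⁽¹⁾(Pair(M))`. -/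
def homothety (x : M) (a : ℝ) (ha : a ≠ 0) : Jet1 E x where
  tgt := x
  map := ContinuousLinearEquiv.smulLeft (Units.mk0 a ha)

/-- A vector field on `M` is smooth. -/
def SmoothField (X : Π x : M, TangentSpace 𝓘(ℝ, E) x) : Prop :=
  ContMDiff 𝓘(ℝ, E) 𝓘(ℝ, E).tangent ∞ (fun x => (⟨x, X x⟩ : T1 E M))

/-- The element `Z_** Y_* X_x` of `T³_x M`. -/
def thirdTangent (X Y Z : Π x : M, TangentSpace 𝓘(ℝ, E) x) (x : M) : T3At E x :=
  ⟨tangentMap 𝓘(ℝ, E).tangent 𝓘(ℝ, E).tangent.tangent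
      (tangentMap 𝓘(ℝ, E) 𝓘(ℝ, E).tangent (fun x => (⟨x, Z x⟩ : T1 E M)))
      (tangentMap 𝓘(ℝ, E) 𝓘(ℝ, E).tangent (fun x => (⟨x, Y x⟩ : T1 E M)) ⟨x, X x⟩), rfl⟩

end AffineJets

end

/-! Everything is computed in the preferred charts at the source and the target. Let Γ be the
Christoffel form (`christoffel`), with the direction of differentiation first, and let A be the
linear part of ξ, with source p and target q. A local bisection is a pair (b⁰, L), acting on TM by
(u, v) ↦ (b⁰(u), L(u)v). Semi-holonomy says Db⁰ = A at p. Differentiating W(b⁰(u)) = L(u)Y(u) turns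
preservation of ∇ into DL(d)a = S(d, a), where S(d, a) = A Γ(d, a) − Γ(Ad, Aa) is `affineForm`
(`fderiv_linRep_iff`). The first derivatives of an affine jet are thus forced by A, which gives
uniqueness of S(ξ). A bisection with these derivatives at p is easily written down, which gives
existence.

The same formula, at moving points, shows that S ∘ α is smooth and acts on T²M by `affineAct`.
Differentiating once more with Db⁰ = A and DL = S gives the action of 𝕊(ξ) in closed form
(`IsAffineExt3.act_mk3`), hence its uniqueness. Write an element of T³M over the source as (a, b, c,
d, e, f, g), with p omitted. Then κ exchanges (b, c) with (d, e). The jets 𝕊(ξ) and κ(𝕊(ξ)) give the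
same values except perhaps in the last two coordinates. The penultimate values are S(d, b) + Af and
S(b, d) + Af. The antisymmetric part of S measures the failure of A to preserve the torsion, so
these agree when ξ preserves it. The last coordinates then differ by A R(d, b)a − R(Ad, Ab)Aa
(`affineForm2_sub`): the mixed terms cancel in pairs and leave the two coordinate expressions of the
curvature.

For Z_** Y_* X the coordinates a, b, d are Z, Y, X (`thirdTangent_coords`), which is the stated
formula. Since a, b, d are arbitrary, vanishing of the defect is preservation of the curvature. For
a homothety of ratio r, trilinearity makes the defect (r − r³)R. -/

noncomputable section

namespace AffineJets

/-! ### Smoothness and tangent maps in induced charts -/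

section Charts

variable {F : Type*} [NormedAddCommGroup F] [NormedSpace ℝ F]
  {H : Type*} [TopologicalSpace H] {I : ModelWithCorners ℝ F H}
  {N : Type*} [TopologicalSpace N] [ChartedSpace H N]
  {F' : Type*} [NormedAddCommGroup F'] [NormedSpace ℝ F']
  {H' : Type*} [TopologicalSpace H'] {I' : ModelWithCorners ℝ F' H'}
  {N' : Type*} [TopologicalSpace N'] [ChartedSpace H' N']

/-- A map that is smooth in charts is smooth. -/
theorem contMDiffAt_of_chart {k : ℕ∞ω} [IsManifold I k N] [IsManifold I' k N'] {f : N → N'}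
    {n n₀ : N} {n₀' : N'} {g : F → F'}
    (hn : n ∈ (chartAt H n₀).source) (hfn : ∀ᶠ m in 𝓝 n, f m ∈ (chartAt H' n₀').source)
    (hg : ∀ᶠ m in 𝓝 n, extChartAt I' n₀' (f m) = g (extChartAt I n₀ m))
    [I'.Boundaryless]
    (hk : ContDiffAt ℝ k g (extChartAt I n₀ n)) : ContMDiffAt I I' k f n := by
  have h1 : ContMDiffAt I 𝓘(ℝ, F') k (fun m => g (extChartAt I n₀ m)) n :=
    hk.contMDiffAt.comp n (contMDiffAt_extChartAt' hn)
  have hm : extChartAt I' n₀' (f n) ∈ (extChartAt I' n₀').target :=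
    (extChartAt I' n₀').map_source (by rw [extChartAt_source]; exact hfn.self_of_nhds)
  have h2 : ContMDiffAt 𝓘(ℝ, F') I' k (extChartAt I' n₀').symm (g (extChartAt I n₀ n)) := by
    rw [← hg.self_of_nhds]
    exact (contMDiffOn_extChartAt_symm n₀').contMDiffAt
      ((isOpen_extChartAt_target n₀').mem_nhds hm)
  refine (h2.comp n h1).congr_of_eventuallyEq ?_
  filter_upwards [hfn, hg] with m h3 h4
  rw [Function.comp_apply, ← h4, (extChartAt I' n₀').left_inv (by rwa [extChartAt_source])]

/-- A smooth map is smooth in charts. -/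
theorem contDiffAt_chart {k : ℕ∞ω} [IsManifold I k N] [IsManifold I' k N'] {f : N → N'}
    {n n₀ : N} {n₀' : N'} [I.Boundaryless]
    (hn : n ∈ (chartAt H n₀).source) (hfn : f n ∈ (chartAt H' n₀').source)
    (hf : ContMDiffAt I I' k f n) :
    ContDiffAt ℝ k (fun u => extChartAt I' n₀' (f ((extChartAt I n₀).symm u)))
      (extChartAt I n₀ n) := by
  have := ((contMDiffAt_iff_of_mem_source hn hfn).1 hf).2
  rwa [I.range_eq_univ, contDiffWithinAt_univ] at this

theorem eventually_chart {n n₀ : N} (hn : n ∈ (chartAt H n₀).source) :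
    ∀ᶠ m in 𝓝 n, m ∈ (chartAt H n₀).source :=
  (chartAt H n₀).open_source.mem_nhds hn

theorem extChartAt_left_inv {n n₀ : N} (hn : n ∈ (chartAt H n₀).source) :
    (extChartAt I n₀).symm (extChartAt I n₀ n) = n :=
  (extChartAt I n₀).left_inv (by rwa [extChartAt_source])

theorem chart_injective {n m n₀ : N} (hn : n ∈ (chartAt H n₀).source)
    (hm : m ∈ (chartAt H n₀).source) (h : extChartAt I n₀ n = extChartAt I n₀ m) : n = m := by
  rw [← extChartAt_left_inv (I := I) hn, h, extChartAt_left_inv hm]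

theorem eventually_symm {n n₀ : N} [I.Boundaryless] (hn : n ∈ (chartAt H n₀).source)
    {p : N → Prop} (hp : ∀ᶠ m in 𝓝 n, p m) :
    ∀ᶠ u in 𝓝 (extChartAt I n₀ n), p ((extChartAt I n₀).symm u) := by
  have h := continuousAt_extChartAt_symm' (I := I) (x := n₀) (x' := n)
    (by rwa [extChartAt_source])
  refine h.eventually ?_
  rwa [extChartAt_left_inv hn]

theorem eventually_target {n n₀ : N} [I.Boundaryless] (hn : n ∈ (chartAt H n₀).source) :
    ∀ᶠ u in 𝓝 (extChartAt I n₀ n), u ∈ (extChartAt I n₀).target :=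
  (isOpen_extChartAt_target n₀).mem_nhds
    ((extChartAt I n₀).map_source (by rwa [extChartAt_source]))

variable [IsManifold I 1 N] [IsManifold I' 1 N']

/-- The chart of `TN` induced by the preferred chart of `N` at `n₀`. -/
def tchart (I : ModelWithCorners ℝ F H) [IsManifold I 1 N] (n₀ : N) :
    PartialEquiv (TangentBundle I N) (F × F) :=
  extChartAt I.tangent (⟨n₀, 0⟩ : TangentBundle I N)

theorem extChartAt_tangent (w : TangentBundle I N) :
    extChartAt I.tangent w = tchart I w.proj := rfl

/-- The fibre coordinate on `T_n N` induced by the preferred chart of `N` at `n₀`. -/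
def fchart (I : ModelWithCorners ℝ F H) [IsManifold I 1 N] (n₀ n : N) :
    TangentSpace I n →L[ℝ] F :=
  (trivializationAt F (TangentSpace I) n₀).continuousLinearMapAt ℝ n

/-- The inverse of `fchart`. -/
def fsymm (I : ModelWithCorners ℝ F H) [IsManifold I 1 N] (n₀ n : N) :
    F →L[ℝ] TangentSpace I n :=
  (trivializationAt F (TangentSpace I) n₀).symmL ℝ n

theorem fchart_fsymm {n₀ n : N} (h : n ∈ (chartAt H n₀).source) (v : F) :
    fchart I n₀ n (fsymm I n₀ n v) = v :=
  Trivialization.continuousLinearMapAt_symmL _ h v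

theorem fsymm_fchart {n₀ n : N} (h : n ∈ (chartAt H n₀).source) (v : TangentSpace I n) :
    fsymm I n₀ n (fchart I n₀ n v) = v :=
  Trivialization.symmL_continuousLinearMapAt _ h v

theorem fchart_injective {n₀ n : N} (h : n ∈ (chartAt H n₀).source) :
    Function.Injective (fchart I n₀ n) :=
  Function.LeftInverse.injective (fsymm_fchart h)

theorem fchart_eq_mfderiv {n₀ n : N} (h : n ∈ (chartAt H n₀).source) :
    fchart I n₀ n = mfderiv I 𝓘(ℝ, F) (extChartAt I n₀) n :=
  TangentBundle.continuousLinearMapAt_trivializationAt h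

theorem fchart_self (n : N) (v : TangentSpace I n) : fchart I n n v = v := by
  rw [fchart_eq_mfderiv (mem_chart_source H n), mfderiv_extChartAt_self]; rfl

theorem mem_tchart_source {n₀ : N} {X : TangentBundle I N} :
    X ∈ (tchart I n₀).source ↔ X.proj ∈ (chartAt H n₀).source := by
  rw [tchart, extChartAt_source]; exact TangentBundle.mem_chart_source_iff _ _

theorem tchart_apply {n₀ : N} {X : TangentBundle I N} (h : X.proj ∈ (chartAt H n₀).source) :
    tchart I n₀ X = (extChartAt I n₀ X.proj, fchart I n₀ X.proj X.2) := by
  ext1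
  · rfl
  · rw [fchart, Trivialization.continuousLinearMapAt_apply,
      Trivialization.coe_linearMapAt_of_mem _ h]
    rfl

theorem tchart_self (n : N) (v : TangentSpace I n) :
    tchart I n ⟨n, v⟩ = (extChartAt I n n, v) := by
  rw [tchart_apply (by exact mem_chart_source H n)]
  exact Prod.ext rfl (fchart_self n v)

/-- The tangent map in charts. -/
theorem tchart_tangentMap {f : N → N'} {X : TangentBundle I N} {n₀ : N} {n₀' : N'} {g : F → F'}
    {L : F →L[ℝ] F'} (hf : MDifferentiableAt I I' f X.proj)
    (hX : X.proj ∈ (chartAt H n₀).source) (hfX : f X.proj ∈ (chartAt H' n₀').source)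
    (hg : ∀ᶠ n in 𝓝 X.proj, extChartAt I' n₀' (f n) = g (extChartAt I n₀ n))
    (hL : HasFDerivAt g L (extChartAt I n₀ X.proj)) :
    tchart I' n₀' (tangentMap I I' f X) =
      (g (extChartAt I n₀ X.proj), L (tchart I n₀ X).2) := by
  rw [tchart_apply hX, tchart_apply (by exact hfX)]
  refine Prod.ext hg.self_of_nhds ?_
  -- The map "`f` read in the target chart" has two factorizations near the point, through `f` and
  -- through `g`; uniqueness of its derivative compares them.
  have h1 : HasMFDerivAt I 𝓘(ℝ, F') (fun n => extChartAt I' n₀' (f n)) X.proj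
      ((mfderiv I' 𝓘(ℝ, F') (extChartAt I' n₀') (f X.proj)).comp (mfderiv I I' f X.proj)) :=
    (mdifferentiableAt_extChartAt hfX).hasMFDerivAt.comp X.proj hf.hasMFDerivAt
  have h2 : HasMFDerivAt I 𝓘(ℝ, F') (fun n => g (extChartAt I n₀ n)) X.proj
      (L.comp (mfderiv I 𝓘(ℝ, F) (extChartAt I n₀) X.proj)) :=
    hL.hasMFDerivAt.comp X.proj (mdifferentiableAt_extChartAt hX).hasMFDerivAt
  have h3 := hasMFDerivAt_unique h1 (h2.congr_of_eventuallyEq hg)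
  have h4 := congrArg (fun A => A X.2) h3
  have h5 := congrArg (fun A => A X.2) (fchart_eq_mfderiv (I := I) hX)
  have h6 := congrArg (fun A => A (mfderiv I I' f X.proj X.2)) (fchart_eq_mfderiv (I := I') hfX)
  exact h6.trans (h4.trans (congrArg L h5.symm))

theorem tchart_symm {n₀ : N} {u : F} (hu : u ∈ (extChartAt I n₀).target) (v : F) :
    (tchart I n₀).symm (u, v) =
      ⟨(extChartAt I n₀).symm u, fsymm I n₀ ((extChartAt I n₀).symm u) v⟩ := by
  have hs : (extChartAt I n₀).symm u ∈ (chartAt H n₀).source := by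
    rw [← extChartAt_source I]; exact (extChartAt I n₀).map_target hu
  have : tchart I n₀ ⟨(extChartAt I n₀).symm u, fsymm I n₀ ((extChartAt I n₀).symm u) v⟩
      = (u, v) := by
    rw [tchart_apply (by exact hs)]
    dsimp only
    rw [fchart_fsymm hs, (extChartAt I n₀).right_inv hu]
  rw [← this]
  exact (tchart I n₀).left_inv (mem_tchart_source.2 hs)

end Charts

/-! ### The projection and the vertical lift in preferred charts -/

section Lifts

variable {F : Type*} [NormedAddCommGroup F] [NormedSpace ℝ F]
  {H : Type*} [TopologicalSpace H] {I : ModelWithCorners ℝ F H}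
  {N : Type*} [TopologicalSpace N] [ChartedSpace H N] [IsManifold I ∞ N]

/-- The derivative of the projection `TN → N` in the preferred charts. -/
theorem mfderiv_proj (X : TangentBundle I N) (w : TangentSpace I.tangent X) :
    mfderiv I.tangent I (fun X : TangentBundle I N => X.proj) X w = (show F × F from w).1 := by
  have h := tchart_tangentMap (I := I.tangent) (I' := I) (N := TangentBundle I N)
    (f := fun X : TangentBundle I N => X.proj)
    (X := (⟨X, w⟩ : TangentBundle I.tangent (TangentBundle I N)))
    (n₀ := X) (n₀' := X.proj) (g := Prod.fst) (L := ContinuousLinearMap.fst ℝ F F)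
    (mdifferentiableAt_proj (TangentSpace I)) (mem_chart_source _ X) (mem_chart_source _ _)
    (Filter.Eventually.of_forall fun _ => rfl) hasFDerivAt_fst
  have h1 := congrArg Prod.snd h
  have h2 := congrArg Prod.snd
    (tchart_self (I := I) X.proj (mfderiv I.tangent I (fun X : TangentBundle I N => X.proj) X w))
  have h3 := congrArg (fun p => p.2.1) (tchart_self (I := I.tangent) X w)
  exact h2.symm.trans (h1.trans h3)

/-- The vertical lift in the preferred charts. -/
theorem vlift_eq [I.Boundaryless] (w : TangentBundle I N) (v : TangentSpace I w.proj) :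
    vlift w v = (show F × F from ((0 : F), (show F from v))) := by
  let f : F → TangentBundle I N := fun u => ⟨w.proj, u⟩
  have hg : ∀ u : F, extChartAt I.tangent w (f u) = (extChartAt I w.proj w.proj, u) :=
    fun u => tchart_self w.proj u
  let u₀ : F := w.2
  have hs : ∀ u : F, f u ∈ (chartAt (ModelProd H F) w).source := fun u => by
    rw [TangentBundle.mem_chart_source_iff]; exact mem_chart_source _ _
  have hf : MDifferentiableAt 𝓘(ℝ, F) I.tangent f u₀ :=
    (contMDiffAt_of_chart (k := 1) (I := 𝓘(ℝ, F)) (I' := I.tangent) (n₀ := u₀) (n₀' := w)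
      (g := fun u => (extChartAt I w.proj w.proj, u)) (mem_chart_source _ _)
      (Filter.Eventually.of_forall fun _ => hs _) (Filter.Eventually.of_forall hg)
      (contDiffAt_const.prodMk contDiffAt_id)).mdifferentiableAt one_ne_zero
  have h := tchart_tangentMap (I := 𝓘(ℝ, F)) (I' := I.tangent) (N' := TangentBundle I N)
    (f := f) (X := (⟨u₀, v⟩ : TangentBundle 𝓘(ℝ, F) F)) (n₀ := u₀) (n₀' := w)
    (g := fun u => (extChartAt I w.proj w.proj, u)) (L := ContinuousLinearMap.inr ℝ F F)
    hf (mem_chart_source _ _) (hs _)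
    (Filter.Eventually.of_forall hg) (hasFDerivAt_prodMk_right _ _)
  have h1 := congrArg Prod.snd h
  have h2 := congrArg Prod.snd
    (tchart_self (I := I.tangent) w (vlift w v))
  have h3 := congrArg Prod.snd (tchart_self (I := 𝓘(ℝ, F)) u₀ v)
  exact h2.symm.trans (h1.trans (congrArg (ContinuousLinearMap.inr ℝ F F) h3))

end Lifts

/-- In a finite basis, `f` is the finite sum of the fixed coordinate functionals tensored with the
vectors `f x (b i)`, so pointwise smoothness suffices for smoothness in operator norm. -/
theorem contDiffAt_clm_of_apply {D E F : Type*} [NormedAddCommGroup D] [NormedSpace ℝ D]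
    [NormedAddCommGroup E] [NormedSpace ℝ E] [FiniteDimensional ℝ E]
    [NormedAddCommGroup F] [NormedSpace ℝ F] {k : ℕ∞ω} {f : D → E →L[ℝ] F} {u : D}
    (h : ∀ v, ContDiffAt ℝ k (fun x => f x v) u) : ContDiffAt ℝ k f u := by
  let b := Module.finBasis ℝ E
  have : f = fun x => ∑ i, ContinuousLinearMap.smulRightL ℝ E F
      (LinearMap.toContinuousLinearMap (b.coord i)) (f x (b i)) := by
    ext x v
    conv_lhs => rw [← b.sum_repr v, map_sum]
    simp
  rw [this]
  exact ContDiffAt.sum fun i _ => (ContinuousLinearMap.contDiff _).contDiffAt.comp u (h (b i))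

/-! ### Vector fields in a chart -/

section Fields

variable {E : Type*} [NormedAddCommGroup E] [NormedSpace ℝ E]
  {M : Type*} [TopologicalSpace M] [ChartedSpace E M] [IsManifold 𝓘(ℝ, E) ∞ M]

/-- A vector field as a section of `TM → M`. -/
def toSection (Y : Π x : M, TangentSpace 𝓘(ℝ, E) x) (x : M) : T1 E M := ⟨x, Y x⟩

/-- The vector field near `x` with constant coordinates in the preferred chart at `x`. -/
def constField (x : M) (a : E) (x' : M) : TangentSpace 𝓘(ℝ, E) x' := fsymm 𝓘(ℝ, E) x x' a

/-- The coordinates of a vector field in the preferred chart at `x`. -/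
def fieldRep (x : M) (Y : Π x : M, TangentSpace 𝓘(ℝ, E) x) (u : E) : E :=
  fchart 𝓘(ℝ, E) x ((extChartAt 𝓘(ℝ, E) x).symm u) (Y ((extChartAt 𝓘(ℝ, E) x).symm u))

/-- Torsion and curvature are evaluated on the extensions `FiberBundle.extend`; this makes them
computable, as these extensions have constant coordinates on the whole chart domain. -/
theorem extend_eq_constField {x x' : M} (hx : x' ∈ (chartAt E x).source)
    (v : TangentSpace 𝓘(ℝ, E) x) :
    FiberBundle.extend E v x' = constField x (show E from v) x' := by
  have h : ((trivializationAt E (TangentSpace 𝓘(ℝ, E)) x) ⟨x, v⟩).2 = (show E from v) := by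
    exact congrArg Prod.snd (tchart_self (I := 𝓘(ℝ, E)) x v)
  rw [constField, fsymm, Trivialization.symmL_apply _ hx]
  exact congrArg (fun w : E => (trivializationAt E (TangentSpace 𝓘(ℝ, E)) x).symm x' w) h

theorem fieldRep_apply {x x' : M} (hx : x' ∈ (chartAt E x).source)
    (Y : Π x : M, TangentSpace 𝓘(ℝ, E) x) :
    fieldRep x Y (extChartAt 𝓘(ℝ, E) x x') = fchart 𝓘(ℝ, E) x x' (Y x') := by
  rw [fieldRep, extChartAt_left_inv hx]

theorem constField_fieldRep {x x' : M} (hx : x' ∈ (chartAt E x).source)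
    (Y : Π x : M, TangentSpace 𝓘(ℝ, E) x) :
    constField x (fieldRep x Y (extChartAt 𝓘(ℝ, E) x x')) x' = Y x' := by
  rw [fieldRep_apply hx, constField, fsymm_fchart hx]

omit [IsManifold 𝓘(ℝ, E) ∞ M] in
theorem symm_mem_source {x : M} {u : E} (hu : u ∈ (extChartAt 𝓘(ℝ, E) x).target) :
    (extChartAt 𝓘(ℝ, E) x).symm u ∈ (chartAt E x).source := by
  rw [← extChartAt_source 𝓘(ℝ, E)]; exact (extChartAt 𝓘(ℝ, E) x).map_target hu

theorem fieldRep_constField {x : M} {u : E} (hu : u ∈ (extChartAt 𝓘(ℝ, E) x).target) (a : E) :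
    fieldRep x (constField x a) u = a :=
  fchart_fsymm (symm_mem_source hu) a

theorem fieldRep_extend {x : M} {u : E} (hu : u ∈ (extChartAt 𝓘(ℝ, E) x).target)
    (v : TangentSpace 𝓘(ℝ, E) x) : fieldRep x (FiberBundle.extend E v) u = v := by
  rw [fieldRep, extend_eq_constField (symm_mem_source hu)]
  exact fieldRep_constField hu _

theorem contDiffAt_fieldRep {x x' : M} (hx : x' ∈ (chartAt E x).source) {k : ℕ∞ω}
    [IsManifold 𝓘(ℝ, E) k M] [IsManifold 𝓘(ℝ, E).tangent k (T1 E M)]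
    {Y : Π x : M, TangentSpace 𝓘(ℝ, E) x}
    (hY : ContMDiffAt 𝓘(ℝ, E) 𝓘(ℝ, E).tangent k (toSection Y) x') :
    ContDiffAt ℝ k (fieldRep x Y) (extChartAt 𝓘(ℝ, E) x x') := by
  have h := contDiffAt_chart (n₀ := x) (n₀' := (⟨x, 0⟩ : T1 E M)) hx
    ((TangentBundle.mem_chart_source_iff _ _).2 hx) hY
  refine (contDiff_snd.contDiffAt.comp _ h).congr_of_eventuallyEq ?_
  filter_upwards [eventually_target (I := 𝓘(ℝ, E)) hx] with u hu
  exact (congrArg Prod.snd (tchart_apply (I := 𝓘(ℝ, E)) (n₀ := x)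
    (X := toSection Y ((extChartAt 𝓘(ℝ, E) x).symm u)) (symm_mem_source hu))).symm

theorem contMDiffAt_of_fieldRep {x x' : M} (hx : x' ∈ (chartAt E x).source) {k : ℕ∞ω}
    [IsManifold 𝓘(ℝ, E) k M] [IsManifold 𝓘(ℝ, E).tangent k (T1 E M)]
    {Y : Π x : M, TangentSpace 𝓘(ℝ, E) x}
    (hY : ContDiffAt ℝ k (fieldRep x Y) (extChartAt 𝓘(ℝ, E) x x')) :
    ContMDiffAt 𝓘(ℝ, E) 𝓘(ℝ, E).tangent k (toSection Y) x' := by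
  refine contMDiffAt_of_chart (I' := 𝓘(ℝ, E).tangent) (n₀ := x) (n₀' := (⟨x, 0⟩ : T1 E M))
    (g := fun u => (u, fieldRep x Y u)) hx ?_ ?_ (contDiffAt_id.prodMk hY)
  · filter_upwards [eventually_chart hx] with m hm
    exact (TangentBundle.mem_chart_source_iff _ _).2 hm
  · filter_upwards [eventually_chart hx] with m hm
    rw [fieldRep_apply hm]
    exact tchart_apply (I := 𝓘(ℝ, E)) (n₀ := x) (X := toSection Y m) hm

theorem contMDiffAt_constField {x x' : M} (hx : x' ∈ (chartAt E x).source) (a : E) :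
    ContMDiffAt 𝓘(ℝ, E) 𝓘(ℝ, E).tangent ∞ (toSection (constField x a)) x' := by
  refine contMDiffAt_of_fieldRep hx (contDiffAt_const (c := a) |>.congr_of_eventuallyEq ?_)
  filter_upwards [eventually_target (I := 𝓘(ℝ, E)) hx] with u hu
  exact fieldRep_constField hu a

end Fields

/-! ### Christoffel form, curvature and torsion in a chart -/

section Christoffel

variable {E : Type*} [NormedAddCommGroup E] [NormedSpace ℝ E] [FiniteDimensional ℝ E]
  {M : Type*} [TopologicalSpace M] [ChartedSpace E M] [IsManifold 𝓘(ℝ, E) ∞ M]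
  (cov : CovariantDerivative 𝓘(ℝ, E) E (TangentSpace 𝓘(ℝ, E) : M → Type _))

/-- The Christoffel form of `∇` in the preferred chart at `x`: the first argument is the direction
of differentiation. -/
def christoffel (x : M) (u : E) : E →L[ℝ] E →L[ℝ] E :=
  ∑ i, (ContinuousLinearMap.smulRightL ℝ E E
      (LinearMap.toContinuousLinearMap ((Module.finBasis ℝ E).coord i))).comp
    ((fchart 𝓘(ℝ, E) x ((extChartAt 𝓘(ℝ, E) x).symm u)).comp
      ((cov (constField x (Module.finBasis ℝ E i)) ((extChartAt 𝓘(ℝ, E) x).symm u)).comp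
        (fsymm 𝓘(ℝ, E) x ((extChartAt 𝓘(ℝ, E) x).symm u))))

theorem christoffel_apply (x : M) (u w v : E) :
    christoffel cov x u w v = ∑ i, (Module.finBasis ℝ E).coord i v •
      fieldRep x (fun x' => cov (constField x (Module.finBasis ℝ E i)) x' (constField x w x')) u := by
  simp only [christoffel, sum_apply]
  rfl

-- Leibniz rule for finite sums. Differentiability is proved along with the formula because the
-- inductive step needs it for the partial sum.
omit [FiniteDimensional ℝ E] in
theorem cov_sum {ι : Type*} (s : Finset ι) {x : M} {g : ι → M → ℝ}
    {σ : ι → Π x : M, TangentSpace 𝓘(ℝ, E) x}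
    (hg : ∀ i ∈ s, MDifferentiableAt 𝓘(ℝ, E) 𝓘(ℝ, ℝ) (g i) x)
    (hσ : ∀ i ∈ s, MDifferentiableAt 𝓘(ℝ, E) 𝓘(ℝ, E).tangent (toSection (σ i)) x) :
    MDifferentiableAt 𝓘(ℝ, E) 𝓘(ℝ, E).tangent
      (toSection (fun x' => ∑ i ∈ s, g i x' • σ i x')) x ∧
    cov (fun x' => ∑ i ∈ s, g i x' • σ i x') x =
      ∑ i ∈ s, (g i x • cov (σ i) x + (mvfderiv 𝓘(ℝ, E) (g i) x).smulRight (σ i x)) := by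
  classical
  induction s using Finset.induction_on with
  | empty =>
    refine ⟨?_, ?_⟩
    · simpa using! mdifferentiableAt_zeroSection (IB := 𝓘(ℝ, E)) ℝ
        (TangentSpace 𝓘(ℝ, E) : M → Type _)
    · simp only [Finset.sum_empty]
      exact congrFun cov.zero x
  | insert i s hi ih =>
    obtain ⟨h1, h2⟩ := ih (fun j hj => hg j (Finset.mem_insert_of_mem hj))
      (fun j hj => hσ j (Finset.mem_insert_of_mem hj))
    have hgi := hg i (Finset.mem_insert_self i s)
    have hsi := hσ i (Finset.mem_insert_self i s)
    have h3 : MDifferentiableAt 𝓘(ℝ, E) 𝓘(ℝ, E).tangent (toSection (g i • σ i)) x :=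
      hgi.smul_section hsi
    have e : (fun x' => ∑ j ∈ insert i s, g j x' • σ j x') =
        g i • σ i + fun x' => ∑ j ∈ s, g j x' • σ j x' := by
      funext x'; rw [Finset.sum_insert hi]; rfl
    rw [e]
    refine ⟨mdifferentiableAt_add_section h3 h1, ?_⟩
    rw [cov.isCovariantDerivativeOnUniv.add h3 h1, cov.isCovariantDerivativeOnUniv.leibniz hsi hgi,
      h2, Finset.sum_insert hi]

/-- The covariant derivative in a chart. -/
theorem fchart_cov {x x' : M} (hx : x' ∈ (chartAt E x).source)
    {Y : Π x : M, TangentSpace 𝓘(ℝ, E) x}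
    (hY : ContMDiffAt 𝓘(ℝ, E) 𝓘(ℝ, E).tangent ∞ (toSection Y) x')
    (w : TangentSpace 𝓘(ℝ, E) x') :
    fchart 𝓘(ℝ, E) x x' (cov Y x' w) =
      fderiv ℝ (fieldRep x Y) (extChartAt 𝓘(ℝ, E) x x') (fchart 𝓘(ℝ, E) x x' w) +
        christoffel cov x (extChartAt 𝓘(ℝ, E) x x') (fchart 𝓘(ℝ, E) x x' w)
          (fchart 𝓘(ℝ, E) x x' (Y x')) := by
  let b := Module.finBasis ℝ E
  let c : Fin (Module.finrank ℝ E) → E →L[ℝ] ℝ := fun i =>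
    LinearMap.toContinuousLinearMap (b.coord i)
  let φ := extChartAt 𝓘(ℝ, E) x
  let g : Fin (Module.finrank ℝ E) → M → ℝ := fun i m => c i (fieldRep x Y (φ m))
  have hYd : DifferentiableAt ℝ (fieldRep x Y) (φ x') :=
    (contDiffAt_fieldRep hx hY).differentiableAt (by simp)
  have hgi : ∀ i, HasMFDerivAt 𝓘(ℝ, E) 𝓘(ℝ, ℝ) (g i) x'
      (((c i).comp (fderiv ℝ (fieldRep x Y) (φ x'))).comp (mfderiv 𝓘(ℝ, E) 𝓘(ℝ, E) φ x')) :=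
    fun i => HasMFDerivAt.comp x' (g := fun u => c i (fieldRep x Y u)) (f := φ)
      (((c i).hasFDerivAt.comp _ hYd.hasFDerivAt).hasMFDerivAt)
      (mdifferentiableAt_extChartAt hx).hasMFDerivAt
  obtain ⟨h1, h2⟩ := cov_sum cov Finset.univ (x := x') (g := g) (σ := fun i => constField x (b i))
    (fun i _ => (hgi i).mdifferentiableAt)
    (fun i _ => (contMDiffAt_constField hx (b i)).mdifferentiableAt (by simp))
  -- Near `x'` the field is expanded in the constant frame of the chart; ∇ is local, so this
  -- expansion may replace `Y`.
  have h3 : cov Y x' = cov (fun m => ∑ i, g i m • constField x (b i) m) x' := by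
    refine cov.isCovariantDerivativeOnUniv.congr_of_eventuallyEq
      (hY.mdifferentiableAt (by simp)) h1 Filter.univ_mem ?_
    filter_upwards [eventually_chart hx] with m hm
    conv_lhs => rw [← constField_fieldRep hm Y, ← b.sum_repr (fieldRep x Y _)]
    rw [constField, map_sum]
    refine Finset.sum_congr rfl fun i _ => ?_
    rw [map_smul]; rfl
  rw [h3, h2, christoffel_apply]
  simp only [sum_apply, map_sum, add_apply, map_add,
    Finset.sum_add_distrib]
  rw [add_comm]
  congr 1
  · have : ∀ i, fchart 𝓘(ℝ, E) x x' (((mvfderiv 𝓘(ℝ, E) (g i) x').smulRight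
        (constField x (b i) x')) w) = b.coord i (fderiv ℝ (fieldRep x Y) (φ x')
          (fchart 𝓘(ℝ, E) x x' w)) • b i := by
      intro i
      rw [ContinuousLinearMap.smulRight_apply, map_smul, constField, fchart_fsymm hx]
      congr 1
      rw [fchart_eq_mfderiv hx, mvfderiv, (hgi i).mfderiv]
      rfl
    rw [Finset.sum_congr rfl fun i _ => this i]
    exact b.sum_repr _
  · refine Finset.sum_congr rfl fun i _ => ?_
    have e1 : constField x (fchart 𝓘(ℝ, E) x x' w) x' = w := fsymm_fchart hx w
    rw [fieldRep_apply hx, e1]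
    change fchart 𝓘(ℝ, E) x x' (g i x' • cov (constField x (b i)) x' w) = _
    rw [map_smul]
    congr 1
    exact congrArg (c i) (fieldRep_apply hx Y)

/-- Smoothness of ∇ is applied to globally smooth fields, whereas constant-coordinate fields are
smooth only on the chart. A bump function equal to 1 near the point cuts them off, without changing
∇ there by locality. -/
theorem contDiffAt_christoffel [T2Space M]
    (hcov : CovariantDerivative.ContMDiffCovariantDerivative cov ∞) {x x' : M}
    (hx : x' ∈ (chartAt E x).source) :
    ContDiffAt ℝ ∞ (christoffel cov x) (extChartAt 𝓘(ℝ, E) x x') := by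
  refine contDiffAt_clm_of_apply fun w => contDiffAt_clm_of_apply fun v => ?_
  simp only [christoffel_apply]
  refine ContDiffAt.sum fun i _ => contDiffAt_const.smul (contDiffAt_fieldRep hx ?_)
  set a := Module.finBasis ℝ E i
  obtain ⟨f, -, hf⟩ := (SmoothBumpFunction.nhds_basis_tsupport (I := 𝓘(ℝ, E)) x').mem_iff.1
    ((chartAt E x).open_source.mem_nhds hx)
  have hσ : ContMDiff 𝓘(ℝ, E) 𝓘(ℝ, E).tangent ∞
      (toSection (fun m => f m • constField x a m)) :=
    ContMDiffOn.smul_section_of_tsupport f.contMDiff.contMDiffOn (chartAt E x).open_source hf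
      fun m hm => (contMDiffAt_constField hm a).contMDiffWithinAt
  have h1 := (hcov.contMDiff.contMDiff (σ := fun m => f m • constField x a m)
    hσ.contMDiffOn).contMDiffAt (x := x') Filter.univ_mem
  have h2 : ContMDiffAt 𝓘(ℝ, E) 𝓘(ℝ, E).tangent ∞ (toSection (fun m =>
      cov (fun m => f m • constField x a m) m (constField x w m))) x' :=
    h1.clm_bundle_apply (contMDiffAt_constField hx w)
  refine h2.congr_of_eventuallyEq ?_
  filter_upwards [eventually_chart hx, f.eventuallyEq_one.eventually_nhds] with m hm hfm
  have : cov (constField x a) m = cov (fun m => f m • constField x a m) m := by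
    refine cov.isCovariantDerivativeOnUniv.congr_of_eventuallyEq
      ((contMDiffAt_constField hm a).mdifferentiableAt (by simp))
      (hσ.contMDiffAt.mdifferentiableAt (by simp)) Filter.univ_mem ?_
    filter_upwards [hfm] with z hz
    rw [hz]; simp
  rw [toSection, this]; rfl

-- Identifies the pullback that defines the Lie bracket of manifolds with `fieldRep`, so that
-- brackets can be computed on coordinates.
omit [FiniteDimensional ℝ E] in
theorem mpullbackWithin_extChartAt_symm {x : M} {u : E}
    (hu : u ∈ (extChartAt 𝓘(ℝ, E) x).target) (Y : Π x : M, TangentSpace 𝓘(ℝ, E) x) :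
    VectorField.mpullbackWithin 𝓘(ℝ, E) 𝓘(ℝ, E) (extChartAt 𝓘(ℝ, E) x).symm Y
      (Set.range 𝓘(ℝ, E)) u = fieldRep x Y u := by
  rw [VectorField.mpullbackWithin_apply, ContinuousLinearMap.inverse_eq
    (mfderivWithin_extChartAt_symm_comp_mfderiv_extChartAt hu)
    (mfderiv_extChartAt_comp_mfderivWithin_extChartAt_symm hu), fieldRep,
    fchart_eq_mfderiv (symm_mem_source hu)]
  rfl

theorem lieBracketWithin_eq_zero_of_eventually_const {F : Type*} [NormedAddCommGroup F]
    [NormedSpace ℝ F] {V W : F → F} {v w u : F} (hV : V =ᶠ[𝓝 u] fun _ => v)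
    (hW : W =ᶠ[𝓝 u] fun _ => w) (s : Set F) :
    VectorField.lieBracketWithin ℝ V W s u = 0 := by
  have hV' := (hV.filter_mono (nhdsWithin_le_nhds (s := s))).fderivWithin_eq (𝕜 := ℝ)
    hV.self_of_nhds
  have hW' := (hW.filter_mono (nhdsWithin_le_nhds (s := s))).fderivWithin_eq (𝕜 := ℝ)
    hW.self_of_nhds
  simp [VectorField.lieBracketWithin, hV', hW']

theorem fderiv_apply_apply {D F G K : Type*} [NormedAddCommGroup D] [NormedSpace ℝ D]
    [NormedAddCommGroup F] [NormedSpace ℝ F] [NormedAddCommGroup G] [NormedSpace ℝ G]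
    [NormedAddCommGroup K] [NormedSpace ℝ K] {B : D → F →L[ℝ] G →L[ℝ] K} {p : D}
    (hB : DifferentiableAt ℝ B p) (a : D) (b : F) (c : G) :
    fderiv ℝ (fun u => B u b c) p a = fderiv ℝ B p a b c := by
  rw [((hB.hasFDerivAt.clm_apply (hasFDerivAt_const _ _)).clm_apply (hasFDerivAt_const _ _)).fderiv]
  simp

-- Both fields have constant coordinates near `x`, so the bracket terms of torsion and curvature
-- disappear.
omit [FiniteDimensional ℝ E] in
theorem mlieBracket_extend (x : M) (u v : TangentSpace 𝓘(ℝ, E) x) :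
    VectorField.mlieBracket 𝓘(ℝ, E) (FiberBundle.extend E u) (FiberBundle.extend E v) x = 0 := by
  have h : ∀ w : TangentSpace 𝓘(ℝ, E) x, VectorField.mpullbackWithin 𝓘(ℝ, E) 𝓘(ℝ, E)
      (extChartAt 𝓘(ℝ, E) x).symm (FiberBundle.extend E w) (Set.range 𝓘(ℝ, E))
      =ᶠ[𝓝 (extChartAt 𝓘(ℝ, E) x x)] fun _ => (show E from w) := by
    intro w
    filter_upwards [eventually_target (I := 𝓘(ℝ, E)) (mem_chart_source E x)] with z hz
    rw [mpullbackWithin_extChartAt_symm hz, fieldRep_extend hz]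
  rw [← VectorField.mlieBracketWithin_univ, VectorField.mlieBracketWithin_apply]
  refine (congrArg _ (lieBracketWithin_eq_zero_of_eventually_const (h u) (h v) _)).trans ?_
  exact map_zero _

omit [FiniteDimensional ℝ E] in
theorem contMDiffAt_extend {x : M} (v : TangentSpace 𝓘(ℝ, E) x) {x' : M}
    (hx : x' ∈ (chartAt E x).source) :
    ContMDiffAt 𝓘(ℝ, E) 𝓘(ℝ, E).tangent ∞ (toSection (FiberBundle.extend E v)) x' := by
  refine (contMDiffAt_constField hx (show E from v)).congr_of_eventuallyEq ?_
  filter_upwards [eventually_chart hx] with m hm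
  rw [toSection, extend_eq_constField hm]; rfl

/-- The covariant derivative of a field with constant coordinates. -/
theorem fieldRep_cov_extend {x : M} (v w : TangentSpace 𝓘(ℝ, E) x) {u : E}
    (hu : u ∈ (extChartAt 𝓘(ℝ, E) x).target) :
    fieldRep x (fun z => cov (FiberBundle.extend E w) z (FiberBundle.extend E v z)) u =
      christoffel cov x u v w := by
  have hm := symm_mem_source hu
  have hr := (extChartAt 𝓘(ℝ, E) x).right_inv hu
  have h := fchart_cov cov hm (contMDiffAt_extend w hm) (FiberBundle.extend E v _)
  have hc : fieldRep x (FiberBundle.extend E w) =ᶠ[𝓝 u] fun _ => (show E from w) := by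
    filter_upwards [(isOpen_extChartAt_target x).mem_nhds hu] with z hz
    exact fieldRep_extend hz w
  rw [hr, hc.fderiv_eq, fderiv_fun_const] at h
  rw [fieldRep]
  refine h.trans ?_
  have e1 := fieldRep_extend hu v
  have e2 := fieldRep_extend hu w
  rw [fieldRep] at e1 e2
  rw [e1, e2]
  exact zero_add _

/-- The curvature of `∇` in the preferred chart at `x`, evaluated at `x`. -/
theorem curvature_eq [T2Space M]
    (hcov : CovariantDerivative.ContMDiffCovariantDerivative cov ∞) (x : M)
    (u v w : TangentSpace 𝓘(ℝ, E) x) :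
    curvature cov x u v w =
      let G := christoffel cov x
      let p := extChartAt 𝓘(ℝ, E) x x
      (fderiv ℝ G p u v w + G p u (G p v w) - (fderiv ℝ G p v u w + G p v (G p u w)) : E) := by
  have hx := mem_chart_source E x
  have key : ∀ a b : TangentSpace 𝓘(ℝ, E) x,
      cov (fun z => cov (FiberBundle.extend E w) z (FiberBundle.extend E b z)) x a =
        (fderiv ℝ (christoffel cov x) (extChartAt 𝓘(ℝ, E) x x) a b w +
          christoffel cov x (extChartAt 𝓘(ℝ, E) x x) a
            (christoffel cov x (extChartAt 𝓘(ℝ, E) x x) b w) : E) := by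
    intro a b
    have hG := contDiffAt_christoffel cov hcov hx
    have h1 : fieldRep x (fun z => cov (FiberBundle.extend E w) z (FiberBundle.extend E b z))
        =ᶠ[𝓝 (extChartAt 𝓘(ℝ, E) x x)] fun u => christoffel cov x u b w := by
      filter_upwards [eventually_target (I := 𝓘(ℝ, E)) hx] with z hz
      exact fieldRep_cov_extend cov b w hz
    have h2 : ContDiffAt ℝ ∞ (fun u => christoffel cov x u b w) (extChartAt 𝓘(ℝ, E) x x) :=
      (hG.clm_apply contDiffAt_const).clm_apply contDiffAt_const
    have h3 := fchart_cov cov hx (contMDiffAt_of_fieldRep hx (h2.congr_of_eventuallyEq h1)) a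
    rw [fchart_self, fchart_self, fchart_self, h1.fderiv_eq] at h3
    have h4 := h1.self_of_nhds
    rw [fieldRep_apply hx, fchart_self] at h4
    rw [h3, h4]
    exact congrArg (· + _) (fderiv_apply_apply (hG.differentiableAt (by simp)) a b w)
  rw [curvature, curvatureField, mlieBracket_extend, map_zero, sub_zero,
    FiberBundle.extend_apply_self, FiberBundle.extend_apply_self, key, key]
  rfl

theorem torsion_eq (x : M) (u v : TangentSpace 𝓘(ℝ, E) x) :
    cov.torsion x u v =
      let G := christoffel cov x
      let p := extChartAt 𝓘(ℝ, E) x x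
      (G p u v - G p v u : E) := by
  have hx := mem_chart_source E x
  have key : ∀ a b : TangentSpace 𝓘(ℝ, E) x,
      cov (FiberBundle.extend E b) x (FiberBundle.extend E a x) =
        (christoffel cov x (extChartAt 𝓘(ℝ, E) x x) a b : E) := by
    intro a b
    have h := fieldRep_cov_extend cov a b (mem_extChartAt_target x)
    rw [fieldRep_apply hx, fchart_self] at h
    exact h
  rw [cov.torsion_apply_eq_extend, mlieBracket_extend, sub_zero, key, key]
  rfl

end Christoffel

/-! ### Local bisections and (1,1)-jets in charts -/

section Jets

variable {E : Type*} [NormedAddCommGroup E] [NormedSpace ℝ E]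
  {M : Type*} [TopologicalSpace M] [ChartedSpace E M] [IsManifold 𝓘(ℝ, E) ∞ M]

/-- The element of `T²M` over `y` with given coordinates in the preferred chart at `y`. -/
def mk2 (y : M) (a b c : E) : T2 E M := ⟨⟨y, a⟩, (b, c)⟩

/-- The element of `T³M` over `y` with given coordinates in the preferred chart at `y`. -/
def mk3 (y : M) (a b c d e f g : E) : T3 E M := ⟨mk2 y a b c, ((d, e), (f, g))⟩

/-- The chart of `T²M` induced by the preferred chart of `M` at `x`. -/
def chart2 (x : M) : PartialEquiv (T2 E M) ((E × E) × (E × E)) :=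
  tchart 𝓘(ℝ, E).tangent (⟨x, 0⟩ : T1 E M)

/-- The chart of `T³M` induced by the preferred chart of `M` at `x`. -/
def chart3 (x : M) : PartialEquiv (T3 E M) (((E × E) × (E × E)) × ((E × E) × (E × E))) :=
  tchart 𝓘(ℝ, E).tangent.tangent (⟨⟨x, 0⟩, 0⟩ : T2 E M)

theorem chart2_mk2 (x : M) (a b c : E) :
    chart2 x (mk2 x a b c) = ((extChartAt 𝓘(ℝ, E) x x, a), (b, c)) := by
  have h := tchart_self (I := 𝓘(ℝ, E).tangent) (⟨x, a⟩ : T1 E M) (b, c)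
  rw [extChartAt_tangent] at h
  have h' : tchart 𝓘(ℝ, E) x (⟨x, a⟩ : T1 E M) = _ := tchart_self x a
  exact h.trans (Prod.ext h' rfl)

theorem chart3_mk3 (x : M) (a b c d e f g : E) :
    chart3 x (mk3 x a b c d e f g) =
      (((extChartAt 𝓘(ℝ, E) x x, a), (b, c)), ((d, e), (f, g))) := by
  have h := tchart_self (I := 𝓘(ℝ, E).tangent.tangent) (mk2 x a b c) ((d, e), (f, g))
  rw [extChartAt_tangent] at h
  exact h.trans (Prod.ext (chart2_mk2 x a b c) rfl)

theorem mem_chart1 {x : M} {w X : T1 E M} (hw : w.proj = x) :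
    X ∈ (chartAt (ModelProd E E) w).source ↔ X.proj ∈ (chartAt E x).source := by
  rw [TangentBundle.mem_chart_source_iff, hw]

theorem mem_chart2 {x : M} {w 𝒳 : T2 E M} (hw : w.proj.proj = x) :
    𝒳 ∈ (chartAt (ModelProd (ModelProd E E) (E × E)) w).source ↔
      𝒳.proj.proj ∈ (chartAt E x).source := by
  rw [TangentBundle.mem_chart_source_iff, TangentBundle.mem_chart_source_iff, hw]

theorem mem_chart3 {x : M} {w 𝔛 : T3 E M} (hw : w.proj.proj.proj = x) :
    𝔛 ∈ (chartAt (ModelProd (ModelProd (ModelProd E E) (E × E)) ((E × E) × (E × E))) w).source ↔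
      𝔛.proj.proj.proj ∈ (chartAt E x).source := by
  rw [TangentBundle.mem_chart_source_iff, mem_chart2 hw]

theorem chart2_injective {x : M} {𝒳 𝒴 : T2 E M} (hX : 𝒳.proj.proj ∈ (chartAt E x).source)
    (hY : 𝒴.proj.proj ∈ (chartAt E x).source) (h : chart2 x 𝒳 = chart2 x 𝒴) : 𝒳 = 𝒴 :=
  chart_injective (I := 𝓘(ℝ, E).tangent.tangent) (n₀ := (⟨⟨x, 0⟩, 0⟩ : T2 E M))
    ((mem_chart2 rfl).2 hX) ((mem_chart2 rfl).2 hY) h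

theorem chart3_injective {x : M} {𝔛 𝔜 : T3 E M} (hX : 𝔛.proj.proj.proj ∈ (chartAt E x).source)
    (hY : 𝔜.proj.proj.proj ∈ (chartAt E x).source) (h : chart3 x 𝔛 = chart3 x 𝔜) : 𝔛 = 𝔜 :=
  chart_injective (I := 𝓘(ℝ, E).tangent.tangent.tangent) (n₀ := (⟨⟨⟨x, 0⟩, 0⟩, 0⟩ : T3 E M))
    ((mem_chart3 rfl).2 hX) ((mem_chart3 rfl).2 hY) h

theorem chart2_fst_fst {x : M} (𝒳 : T2 E M) :
    (chart2 x 𝒳).1.1 = extChartAt 𝓘(ℝ, E) x 𝒳.proj.proj := rfl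

/-- The coordinate expression of a 1-jet in the preferred charts at `x` and `y`. -/
def jetRep (x y : M) {x' : M} (ξ : Jet1 E x') : E →L[ℝ] E :=
  (fchart 𝓘(ℝ, E) y ξ.tgt).comp ((ξ.map : TangentSpace 𝓘(ℝ, E) x' →L[ℝ] _).comp
    (fsymm 𝓘(ℝ, E) x x'))

theorem jetRep_fchart {x y x' : M} (hx : x' ∈ (chartAt E x).source) (ξ : Jet1 E x')
    (v : TangentSpace 𝓘(ℝ, E) x') :
    jetRep x y ξ (fchart 𝓘(ℝ, E) x x' v) = fchart 𝓘(ℝ, E) y ξ.tgt (ξ.map v) :=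
  congrArg (fun w => fchart 𝓘(ℝ, E) y ξ.tgt (ξ.map w)) (fsymm_fchart hx v)

theorem jetRep_self {x : M} (ξ : Jet1 E x) (v : E) : jetRep x ξ.tgt ξ v = ξ.map v := by
  exact (congrArg (jetRep x ξ.tgt ξ) (fchart_self (I := 𝓘(ℝ, E)) x v)).symm.trans
    ((jetRep_fchart (mem_chart_source E x) ξ v).trans (fchart_self _ (ξ.map v)))

namespace LocBis1

variable {x₀ : M} (b : LocBis1 E x₀)

/-- The underlying local diffeomorphism of a local bisection, in charts. -/
def baseRep (x y : M) (u : E) : E :=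
  extChartAt 𝓘(ℝ, E) y (b.base ((extChartAt 𝓘(ℝ, E) x).symm u))

/-- The linear part of a local bisection, in charts. -/
def linRep (x y : M) (u : E) : E →L[ℝ] E := jetRep x y (b.toFun ((extChartAt 𝓘(ℝ, E) x).symm u))

variable {b} {x y x' : M}

theorem baseRep_apply (hx : x' ∈ (chartAt E x).source) :
    b.baseRep x y (extChartAt 𝓘(ℝ, E) x x') = extChartAt 𝓘(ℝ, E) y (b.base x') := by
  rw [baseRep, extChartAt_left_inv hx]

theorem linRep_apply (hx : x' ∈ (chartAt E x).source) :
    b.linRep x y (extChartAt 𝓘(ℝ, E) x x') = jetRep x y (b.toFun x') := by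
  rw [linRep, extChartAt_left_inv hx]

theorem tchart_act {X : T1 E M} (hx : X.proj ∈ (chartAt E x).source)
    (hy : b.base X.proj ∈ (chartAt E y).source) :
    tchart 𝓘(ℝ, E) y (b.act X) = (b.baseRep x y (tchart 𝓘(ℝ, E) x X).1,
      b.linRep x y (tchart 𝓘(ℝ, E) x X).1 (tchart 𝓘(ℝ, E) x X).2) := by
  rw [tchart_apply hx, tchart_apply (X := b.act X) hy]
  dsimp only
  rw [baseRep_apply hx, linRep_apply hx, jetRep_fchart hx]
  rfl

theorem contMDiffAt_base (hd : x' ∈ b.dom) : ContMDiffAt 𝓘(ℝ, E) 𝓘(ℝ, E) ∞ b.base x' :=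
  (b.localDiffeo.contMDiffOn).contMDiffAt (b.isOpen_dom.mem_nhds hd)

theorem contMDiffAt_act {X : T1 E M} (hd : X.proj ∈ b.dom) :
    ContMDiffAt 𝓘(ℝ, E).tangent 𝓘(ℝ, E).tangent ∞ b.act X :=
  b.smooth.contMDiffAt ((b.isOpen_dom.preimage (FiberBundle.continuous_proj E _)).mem_nhds hd)

theorem eventually_mem (hd : x' ∈ b.dom) (hx : x' ∈ (chartAt E x).source)
    (hy : b.base x' ∈ (chartAt E y).source) :
    ∀ᶠ m in 𝓝 x', m ∈ b.dom ∧ m ∈ (chartAt E x).source ∧ b.base m ∈ (chartAt E y).source := by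
  filter_upwards [b.isOpen_dom.mem_nhds hd, eventually_chart hx,
    (contMDiffAt_base hd).continuousAt.eventually (eventually_chart hy)] with m h1 h2 h3
  exact ⟨h1, h2, h3⟩

theorem contDiffAt_baseRep (hd : x' ∈ b.dom) (hx : x' ∈ (chartAt E x).source)
    (hy : b.base x' ∈ (chartAt E y).source) :
    ContDiffAt ℝ ∞ (b.baseRep x y) (extChartAt 𝓘(ℝ, E) x x') :=
  contDiffAt_chart hx hy (contMDiffAt_base hd)

/-- Smoothness of a bisection is given as smoothness of (u, v) ↦ (b⁰(u), L(u)v) on TM. Fixing v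
makes u ↦ L(u)v smooth, and finite dimension upgrades this to L itself. -/
theorem contDiffAt_linRep [FiniteDimensional ℝ E] (hd : x' ∈ b.dom)
    (hx : x' ∈ (chartAt E x).source) (hy : b.base x' ∈ (chartAt E y).source) :
    ContDiffAt ℝ ∞ (b.linRep x y) (extChartAt 𝓘(ℝ, E) x x') := by
  refine contDiffAt_clm_of_apply fun v => ?_
  let X : T1 E M := ⟨x', fsymm 𝓘(ℝ, E) x x' v⟩
  have hX : tchart 𝓘(ℝ, E) x X = (extChartAt 𝓘(ℝ, E) x x', v) := by
    rw [tchart_apply (by exact hx)]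
    exact Prod.ext rfl (fchart_fsymm hx v)
  have h := contDiffAt_chart (n := X) (n₀ := (⟨x, 0⟩ : T1 E M)) (n₀' := (⟨y, 0⟩ : T1 E M))
    ((mem_chart1 rfl).2 hx) ((mem_chart1 rfl).2 hy) (contMDiffAt_act hd)
  replace h : ContDiffAt ℝ ∞ (fun p => tchart 𝓘(ℝ, E) y (b.act ((tchart 𝓘(ℝ, E) x).symm p)))
    (tchart 𝓘(ℝ, E) x X) := h
  rw [hX] at h
  have h2 := contDiff_snd.contDiffAt.comp _ (h.comp (extChartAt 𝓘(ℝ, E) x x')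
    (contDiffAt_id.prodMk contDiffAt_const))
  refine h2.congr_of_eventuallyEq ?_
  filter_upwards [eventually_target (I := 𝓘(ℝ, E)) hx,
    eventually_symm (I := 𝓘(ℝ, E)) hx (eventually_mem hd hx hy)] with u hu hu'
  have e : tchart 𝓘(ℝ, E) x ((tchart 𝓘(ℝ, E) x).symm (u, v)) = (u, v) := by
    rw [tchart_symm hu, tchart_apply (by exact hu'.2.1)]
    dsimp only
    rw [fchart_fsymm hu'.2.1, (extChartAt 𝓘(ℝ, E) x).right_inv hu]
  have e2 := tchart_act (b := b) (X := (tchart 𝓘(ℝ, E) x).symm (u, v)) (x := x) (y := y)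
    (by rw [tchart_symm hu]; exact hu'.2.1) (by rw [tchart_symm hu]; exact hu'.2.2)
  rw [e] at e2
  exact (congrArg Prod.snd e2).symm

/-- The product rule applied to (u, v) ↦ (b⁰(u), L(u)v). It shows that the jet depends only on the
values and first derivatives of b⁰ and L at the source. -/
theorem chart2_jetAct [FiniteDimensional ℝ E] (hx : x₀ ∈ (chartAt E x).source)
    (hy : b.base x₀ ∈ (chartAt E y).source) (𝒳 : T2At E x₀) :
    chart2 y (b.jetAct 𝒳) =
      let u := extChartAt 𝓘(ℝ, E) x x₀
      let p := chart2 x 𝒳.1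
      ((b.baseRep x y u, b.linRep x y u p.1.2), (fderiv ℝ (b.baseRep x y) u p.2.1,
        fderiv ℝ (b.linRep x y) u p.2.1 p.1.2 + b.linRep x y u p.2.2)) := by
  obtain ⟨𝒳, rfl⟩ := 𝒳
  have hB : HasFDerivAt (b.baseRep x y) _ (tchart 𝓘(ℝ, E) x 𝒳.proj).1 :=
    ((contDiffAt_baseRep b.mem_dom hx hy).differentiableAt (by simp)).hasFDerivAt
  have hL : HasFDerivAt (b.linRep x y) _ (tchart 𝓘(ℝ, E) x 𝒳.proj).1 :=
    ((contDiffAt_linRep b.mem_dom hx hy).differentiableAt (by simp)).hasFDerivAt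
  have hg := (hB.comp (tchart 𝓘(ℝ, E) x 𝒳.proj) hasFDerivAt_fst).prodMk
    ((hL.comp (tchart 𝓘(ℝ, E) x 𝒳.proj) hasFDerivAt_fst).clm_apply hasFDerivAt_snd)
  have h := tchart_tangentMap (X := 𝒳) (n₀ := (⟨x, 0⟩ : T1 E M)) (n₀' := (⟨y, 0⟩ : T1 E M))
    ((contMDiffAt_act b.mem_dom).mdifferentiableAt (by simp))
    ((mem_chart1 rfl).2 hx) ((mem_chart1 rfl).2 hy) ?_ hg
  · refine h.trans ?_
    refine Prod.ext rfl (Prod.ext rfl ?_)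
    exact add_comm _ _
  · have hc := (FiberBundle.continuous_proj E (TangentSpace 𝓘(ℝ, E) : M → Type _)).continuousAt
      (x := 𝒳.proj)
    filter_upwards [hc.eventually (eventually_mem b.mem_dom hx hy)] with X hX
    exact tchart_act hX.2.1 hX.2.2

end LocBis1

omit [IsManifold 𝓘(ℝ, E) ∞ M] in
theorem mk_snd_eq {X : T1 E M} {y : M} (h : X.proj = y) :
    (⟨y, (show E from X.2)⟩ : T1 E M) = X := by
  subst h; rfl

/-! ### The chart equation of affine jets; uniqueness of S(ξ) -/

section Affine

variable [FiniteDimensional ℝ E]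
  (cov : CovariantDerivative 𝓘(ℝ, E) E (TangentSpace 𝓘(ℝ, E) : M → Type _))

/-- The derivative along `d` of the linear part of an affine extension of the 1-jet with linear
part `A`, source `p` and target `q`, applied to `a`, in the preferred charts at `x` and `y`. -/
def affineForm (x y : M) (p q : E) (A : E →L[ℝ] E) (d a : E) : E :=
  A (christoffel cov x p d a) - christoffel cov y q (A d) (A a)

variable {cov} {x₀ : M} {b : LocBis1 E x₀} {x y : M}

omit [FiniteDimensional ℝ E] in
theorem LocBis1.Semiholonomic.fderiv_baseRep (hb : b.Semiholonomic)
    (hx : x₀ ∈ (chartAt E x).source) (hy : b.base x₀ ∈ (chartAt E y).source) (d : E) :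
    fderiv ℝ (b.baseRep x y) (extChartAt 𝓘(ℝ, E) x x₀) d = jetRep x y (b.toFun x₀) d := by
  have hB := ((b.contDiffAt_baseRep b.mem_dom hx hy).differentiableAt (by simp)).hasFDerivAt
  have h := tchart_tangentMap (X := (⟨x₀, fsymm 𝓘(ℝ, E) x x₀ d⟩ : T1 E M))
    ((b.contMDiffAt_base b.mem_dom).mdifferentiableAt (by simp)) hx hy
    (by filter_upwards [eventually_chart hx] with m hm using (b.baseRep_apply hm).symm) hB
  have h2 := congrArg Prod.snd h
  rw [tchart_apply (by exact hy), tchart_apply (by exact hx)] at h2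
  dsimp only [tangentMap] at h2
  rw [fchart_fsymm hx, hb] at h2
  exact h2.symm

/-- Differentiating W(b⁰(u)) = L(u)Y(u) along d gives DW(Ad) = DL(d)Y + L DY(d), where `hs` has
replaced Db⁰ by A. Substituted in the equation L(∇Y) = ∇W, the derivative of Y cancels, and only its
value at the source remains. -/
theorem fderiv_linRep_iff (hx : x₀ ∈ (chartAt E x).source)
    (hy : b.base x₀ ∈ (chartAt E y).source)
    (hs : ∀ d, fderiv ℝ (b.baseRep x y) (extChartAt 𝓘(ℝ, E) x x₀) d = jetRep x y (b.toFun x₀) d)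
    {Y W : Π x' : M, TangentSpace 𝓘(ℝ, E) x'}
    (hY : ContMDiffAt 𝓘(ℝ, E) 𝓘(ℝ, E).tangent ∞ (toSection Y) x₀)
    (hW : ContMDiffAt 𝓘(ℝ, E) 𝓘(ℝ, E).tangent ∞ (toSection W) (b.base x₀))
    (hYW : ∀ᶠ x' in 𝓝 x₀, W (b.toFun x').tgt = (b.toFun x').map (Y x'))
    (u : TangentSpace 𝓘(ℝ, E) x₀) :
    (b.toFun x₀).map (cov Y x₀ u) = cov W (b.toFun x₀).tgt ((b.toFun x₀).map u) ↔
      fderiv ℝ (b.linRep x y) (extChartAt 𝓘(ℝ, E) x x₀) (fchart 𝓘(ℝ, E) x x₀ u)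
        (fchart 𝓘(ℝ, E) x x₀ (Y x₀)) =
      affineForm cov x y (extChartAt 𝓘(ℝ, E) x x₀) (extChartAt 𝓘(ℝ, E) y (b.base x₀))
        (jetRep x y (b.toFun x₀)) (fchart 𝓘(ℝ, E) x x₀ u) (fchart 𝓘(ℝ, E) x x₀ (Y x₀)) := by
  set p := extChartAt 𝓘(ℝ, E) x x₀ with hp
  have hB : HasFDerivAt (b.baseRep x y) _ p :=
    ((b.contDiffAt_baseRep b.mem_dom hx hy).differentiableAt (by simp)).hasFDerivAt
  have hL : HasFDerivAt (b.linRep x y) _ p :=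
    ((b.contDiffAt_linRep b.mem_dom hx hy).differentiableAt (by simp)).hasFDerivAt
  have hYr : HasFDerivAt (fieldRep x Y) _ p :=
    ((contDiffAt_fieldRep hx hY).differentiableAt (by simp)).hasFDerivAt
  have hWr : HasFDerivAt (fieldRep y W)
      (fderiv ℝ (fieldRep y W) (b.baseRep x y p)) (b.baseRep x y p) := by
    rw [hp, b.baseRep_apply hx]
    exact ((contDiffAt_fieldRep hy hW).differentiableAt (by simp)).hasFDerivAt
  have hev : (fun u => fieldRep y W (b.baseRep x y u)) =ᶠ[𝓝 p]
      fun u => b.linRep x y u (fieldRep x Y u) := by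
    filter_upwards [eventually_target (I := 𝓘(ℝ, E)) hx, eventually_symm (I := 𝓘(ℝ, E)) hx hYW,
      eventually_symm (I := 𝓘(ℝ, E)) hx (b.eventually_mem b.mem_dom hx hy)] with u hu h1 h2
    rw [LocBis1.baseRep, fieldRep_apply h2.2.2, LocBis1.linRep, fieldRep, jetRep_fchart h2.2.1]
    exact congrArg _ h1
  have hD := (hWr.comp p hB).unique ((hL.clm_apply hYr).congr_of_eventuallyEq hev)
  have hD2 := congrArg (fun A => A (fchart 𝓘(ℝ, E) x x₀ u)) hD
  simp only [ContinuousLinearMap.comp_apply, add_apply,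
    ContinuousLinearMap.flip_apply] at hD2
  rw [hs, jetRep_fchart hx] at hD2
  have hW0 : W (b.toFun x₀).tgt = (b.toFun x₀).map (Y x₀) := hYW.self_of_nhds
  have hp0 : b.baseRep x y p = extChartAt 𝓘(ℝ, E) y (b.toFun x₀).tgt := b.baseRep_apply hx
  have hinj := (fchart_injective (I := 𝓘(ℝ, E)) (n₀ := y) (n := (b.toFun x₀).tgt) hy).eq_iff
    (a := (b.toFun x₀).map (cov Y x₀ u)) (b := cov W (b.toFun x₀).tgt ((b.toFun x₀).map u))
  rw [← hinj, ← jetRep_fchart hx,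
    fchart_cov cov hx hY, fchart_cov cov (x' := (b.toFun x₀).tgt) hy hW, hW0, map_add, affineForm,
    ← hp0, hD2, hp, fieldRep_apply hx, b.linRep_apply hx, jetRep_fchart hx, jetRep_fchart hx,
    ← hp, hp0, add_assoc, add_right_inj, eq_sub_iff_add_eq, eq_comm]
  rfl

/-- The derivative of the linear part of a local bisection that represents an affine jet. -/
theorem LocBis1.PreservesCov.fderiv_linRep (hc : b.PreservesCov cov)
    (hx : x₀ ∈ (chartAt E x).source) (hy : b.base x₀ ∈ (chartAt E y).source)
    (hs : ∀ d, fderiv ℝ (b.baseRep x y) (extChartAt 𝓘(ℝ, E) x x₀) d = jetRep x y (b.toFun x₀) d)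
    (d a : E) :
    fderiv ℝ (b.linRep x y) (extChartAt 𝓘(ℝ, E) x x₀) d a =
      affineForm cov x y (extChartAt 𝓘(ℝ, E) x x₀) (extChartAt 𝓘(ℝ, E) y (b.base x₀))
        (jetRep x y (b.toFun x₀)) d a := by
  have hl := b.localDiffeo ⟨x₀, b.mem_dom⟩
  let h := hl.localInverse
  -- Since only the value of the test field at `x₀` matters, a constant-coordinate field suffices.
  -- `W` is its transport, built with a local inverse of the base map; copying the raw fibre
  -- coordinate is legitimate because the base points agree near the target.
  let Y := constField x a
  let W : Π y' : M, TangentSpace 𝓘(ℝ, E) y' := fun y' =>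
    (show E from (b.act (toSection Y (h y'))).2)
  have hY : ContMDiffAt 𝓘(ℝ, E) 𝓘(ℝ, E).tangent ∞ (toSection Y) x₀ := contMDiffAt_constField hx a
  have hh0 : h (b.base x₀) = x₀ := hl.localInverse_left_inv hl.localInverse_mem_target
  have hh : ContMDiffAt 𝓘(ℝ, E) 𝓘(ℝ, E) ∞ h (b.base x₀) := hl.localInverse_contMDiffAt
  have hWe : toSection W =ᶠ[𝓝 (b.base x₀)] fun y' => b.act (toSection Y (h y')) := by
    filter_upwards [hl.localInverse_eventuallyEq_right] with y' hy'
    have : (b.act (toSection Y (h y'))).proj = y' := hy'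
    exact mk_snd_eq this
  have hW : ContMDiffAt 𝓘(ℝ, E) 𝓘(ℝ, E).tangent ∞ (toSection W) (b.base x₀) := by
    refine ContMDiffAt.congr_of_eventuallyEq ?_ hWe
    refine ContMDiffAt.comp (I' := 𝓘(ℝ, E).tangent) (b.base x₀) (g := b.act)
      (f := fun y' => toSection Y (h y')) ?_ ?_
    · exact b.contMDiffAt_act (by rw [hh0]; exact b.mem_dom)
    · refine ContMDiffAt.comp (I' := 𝓘(ℝ, E)) (b.base x₀) (g := toSection Y) (f := h) ?_ hh
      rw [hh0]; exact hY
  have hYW : ∀ᶠ x' in 𝓝 x₀, W (b.toFun x').tgt = (b.toFun x').map (Y x') := by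
    filter_upwards [hl.localInverse_eventuallyEq_left] with x' hx'
    have : h (b.toFun x').tgt = x' := hx'
    change (show E from (b.act (toSection Y (h (b.toFun x').tgt))).2) = _
    rw [this]; rfl
  have := (fderiv_linRep_iff hx hy hs hY hW hYW (fsymm 𝓘(ℝ, E) x x₀ d)).1 (hc Y W hY hW hYW _)
  have hYa : fchart 𝓘(ℝ, E) x x₀ (Y x₀) = a := fchart_fsymm hx a
  rwa [fchart_fsymm hx, hYa] at this

/-- The action of `S(ξ)` in charts. -/
theorem IsAffineExt.chart2_act {ξ : Jet1 E x₀} {j : Jet11 E x₀} (hj : IsAffineExt cov ξ j)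
    (hx : x₀ ∈ (chartAt E x).source) (hy : ξ.tgt ∈ (chartAt E y).source) (𝒳 : T2At E x₀) :
    chart2 y (j.act 𝒳) =
      let p := extChartAt 𝓘(ℝ, E) x x₀
      let q := extChartAt 𝓘(ℝ, E) y ξ.tgt
      let A := jetRep x y ξ
      let X := chart2 x 𝒳.1
      ((q, A X.1.2), (A X.2.1, affineForm cov x y p q A X.2.1 X.1.2 + A X.2.2)) := by
  obtain ⟨b, hb, rfl, hs, hc⟩ := hj
  have hs' := hs.fderiv_baseRep hx hy
  rw [hb, LocBis1.chart2_jetAct hx hy]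
  dsimp only
  rw [hs', hc.fderiv_linRep hx hy hs', b.baseRep_apply hx, b.linRep_apply hx]
  rfl

omit [FiniteDimensional ℝ E] in
theorem IsAffineExt.tgt_act {ξ : Jet1 E x₀} {j : Jet11 E x₀} (hj : IsAffineExt cov ξ j)
    (𝒳 : T2At E x₀) : (j.act 𝒳).proj.proj = ξ.tgt := by
  obtain ⟨b, hb, rfl, -, -⟩ := hj
  obtain ⟨𝒳, rfl⟩ := 𝒳
  rw [hb]; rfl

omit [FiniteDimensional ℝ E] in
theorem IsAffineExt.tgt_eq {ξ : Jet1 E x₀} {j : Jet11 E x₀} (hj : IsAffineExt cov ξ j) :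
    j.tgt = ξ.tgt := hj.tgt_act _

/-- `S(ξ)` is unique. -/
theorem IsAffineExt.unique {ξ : Jet1 E x₀} {j j' : Jet11 E x₀} (hj : IsAffineExt cov ξ j)
    (hj' : IsAffineExt cov ξ j') : j = j' := by
  ext1
  funext 𝒳
  have hx := mem_chart_source E x₀
  have hy := mem_chart_source E ξ.tgt
  refine chart2_injective (x := ξ.tgt) (by rw [hj.tgt_act]; exact hy)
    (by rw [hj'.tgt_act]; exact hy) ?_
  rw [hj.chart2_act hx hy, hj'.chart2_act hx hy]

end Affine

end Jets

/-! ### The action of 𝕊(ξ) on T³M; uniqueness -/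

section Third

variable {E : Type*} [NormedAddCommGroup E] [NormedSpace ℝ E] [FiniteDimensional ℝ E]
  {M : Type*} [TopologicalSpace M] [ChartedSpace E M] [IsManifold 𝓘(ℝ, E) ∞ M]
  (cov : CovariantDerivative 𝓘(ℝ, E) E (TangentSpace 𝓘(ℝ, E) : M → Type _))

/-- In charts, the action on `T²M` of the bisection `S ∘ a` of the groupoid of `(1,1)`-jets, for a
bisection `a` with base `a₀` and linear part `A`. -/
def affineAct (x y : M) (a₀ : E → E) (A : E → E →L[ℝ] E) (z : (E × E) × (E × E)) :
    (E × E) × (E × E) :=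
  ((a₀ z.1.1, A z.1.1 z.1.2), (A z.1.1 z.2.1,
    affineForm cov x y z.1.1 (a₀ z.1.1) (A z.1.1) z.2.1 z.1.2 + A z.1.1 z.2.2))

/-- The last coordinate of the action of `𝕊(ξ)`, where `A` is the linear part of `ξ`. -/
def affineForm2 (x y : M) (p q : E) (A : E →L[ℝ] E) (a b c d e f g : E) : E :=
  affineForm cov x y p q A d (christoffel cov x p b a) +
      A (fderiv ℝ (christoffel cov x) p d b a + christoffel cov x p f a + christoffel cov x p b e) -
    (fderiv ℝ (christoffel cov y) q (A d) (A b) (A a) +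
      christoffel cov y q (affineForm cov x y p q A d b + A f) (A a) +
      christoffel cov y q (A b) (affineForm cov x y p q A d a + A e)) +
    (affineForm cov x y p q A d c + A g)

variable {cov}

/-- Hypotheses `h1` and `h2` say that the 1-jet of the bisection is affine. They eliminate the
derivatives of `a₀` and `A`, so the result depends only on `p`, `a₀ p`, `A p` and the first
derivatives of Γ: this is why 𝕊(ξ) does not depend on the chosen bisection. -/
theorem hasFDerivAt_affineAct {x y : M} {a₀ : E → E} {A : E → E →L[ℝ] E} {p : E} {a b c : E}
    (ha₀ : DifferentiableAt ℝ a₀ p) (hA : DifferentiableAt ℝ A p)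
    (hx : DifferentiableAt ℝ (christoffel cov x) p)
    (hy : DifferentiableAt ℝ (christoffel cov y) (a₀ p))
    (h1 : ∀ d, fderiv ℝ a₀ p d = A p d)
    (h2 : ∀ d v, fderiv ℝ A p d v = affineForm cov x y p (a₀ p) (A p) d v) :
    ∃ L : (E × E) × (E × E) →L[ℝ] (E × E) × (E × E),
      HasFDerivAt (affineAct cov x y a₀ A) L ((p, a), (b, c)) ∧
      ∀ d e f g : E, L ((d, e), (f, g)) =
        ((A p d, affineForm cov x y p (a₀ p) (A p) d a + A p e),
          (affineForm cov x y p (a₀ p) (A p) d b + A p f,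
            affineForm2 cov x y p (a₀ p) (A p) a b c d e f g)) := by
  let z₀ : (E × E) × (E × E) := ((p, a), (b, c))
  have hu : HasFDerivAt (fun z : (E × E) × (E × E) => z.1.1)
      ((ContinuousLinearMap.fst ℝ E E).comp (ContinuousLinearMap.fst ℝ (E × E) (E × E))) z₀ :=
    ((ContinuousLinearMap.fst ℝ E E).comp (ContinuousLinearMap.fst ℝ (E × E) (E × E))).hasFDerivAt
  have ha : HasFDerivAt (fun z : (E × E) × (E × E) => z.1.2)
      ((ContinuousLinearMap.snd ℝ E E).comp (ContinuousLinearMap.fst ℝ (E × E) (E × E))) z₀ :=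
    ((ContinuousLinearMap.snd ℝ E E).comp (ContinuousLinearMap.fst ℝ (E × E) (E × E))).hasFDerivAt
  have hb : HasFDerivAt (fun z : (E × E) × (E × E) => z.2.1)
      ((ContinuousLinearMap.fst ℝ E E).comp (ContinuousLinearMap.snd ℝ (E × E) (E × E))) z₀ :=
    ((ContinuousLinearMap.fst ℝ E E).comp (ContinuousLinearMap.snd ℝ (E × E) (E × E))).hasFDerivAt
  have hc : HasFDerivAt (fun z : (E × E) × (E × E) => z.2.2)
      ((ContinuousLinearMap.snd ℝ E E).comp (ContinuousLinearMap.snd ℝ (E × E) (E × E))) z₀ :=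
    ((ContinuousLinearMap.snd ℝ E E).comp (ContinuousLinearMap.snd ℝ (E × E) (E × E))).hasFDerivAt
  have ha₀' : HasFDerivAt (fun z : (E × E) × (E × E) => a₀ z.1.1) _ z₀ :=
    HasFDerivAt.comp z₀ ha₀.hasFDerivAt hu
  have hA' : HasFDerivAt (fun z : (E × E) × (E × E) => A z.1.1) _ z₀ :=
    HasFDerivAt.comp z₀ hA.hasFDerivAt hu
  have hx' : HasFDerivAt (fun z : (E × E) × (E × E) => christoffel cov x z.1.1)
      ((fderiv ℝ (christoffel cov x) p).comp ((ContinuousLinearMap.fst ℝ E E).comp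
        (ContinuousLinearMap.fst ℝ (E × E) (E × E)))) z₀ :=
    HasFDerivAt.comp (g := christoffel cov x) z₀ hx.hasFDerivAt hu
  have hy' : HasFDerivAt (fun z : (E × E) × (E × E) => christoffel cov y (a₀ z.1.1))
      ((fderiv ℝ (christoffel cov y) (a₀ p)).comp ((fderiv ℝ a₀ p).comp
        ((ContinuousLinearMap.fst ℝ E E).comp (ContinuousLinearMap.fst ℝ (E × E) (E × E))))) z₀ :=
    HasFDerivAt.comp (g := christoffel cov y) z₀ hy.hasFDerivAt ha₀'
  have hAb := hA'.clm_apply hb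
  have hAa := hA'.clm_apply ha
  have hS := (hA'.clm_apply ((hx'.clm_apply hb).clm_apply ha)).sub
    ((hy'.clm_apply hAb).clm_apply hAa)
  refine ⟨_, (ha₀'.prodMk hAa).prodMk (hAb.prodMk (hS.add (hA'.clm_apply hc))), ?_⟩
  intro d e f g
  simp only [z₀, ContinuousLinearMap.prod_apply, add_apply,
    sub_apply, ContinuousLinearMap.comp_apply, ContinuousLinearMap.flip_apply,
    ContinuousLinearMap.coe_fst', ContinuousLinearMap.coe_snd', h1, h2,
    affineForm2, map_add, Prod.mk.injEq, true_and]
  refine ⟨by abel, by abel, by abel⟩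

omit [FiniteDimensional ℝ E] in
theorem LocBis11.contMDiffAt_act {x : M} (β : LocBis11 E x) {𝒳 : T2 E M}
    (hd : 𝒳.proj.proj ∈ β.dom) :
    ContMDiffAt 𝓘(ℝ, E).tangent.tangent 𝓘(ℝ, E).tangent.tangent ∞ β.act 𝒳 :=
  β.smooth.contMDiffAt ((β.isOpen_dom.preimage ((FiberBundle.continuous_proj E _).comp
    (FiberBundle.continuous_proj (E × E) _))).mem_nhds hd)

/-- The derivatives of a local bisection whose 1-jet is affine. -/
theorem IsAffineExt.fderiv_eq {x : M} {α : LocBis1 E x} {j : Jet11 E x}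
    (hj : IsAffineExt cov (α.toFun x) j) (hjα : j.act = α.jetAct) :
    let y := (α.toFun x).tgt
    let p := extChartAt 𝓘(ℝ, E) x x
    (∀ d, fderiv ℝ (α.baseRep x y) p d = α.linRep x y p d) ∧
    ∀ d v, fderiv ℝ (α.linRep x y) p d v =
      affineForm cov x y p (α.baseRep x y p) (α.linRep x y p) d v := by
  intro y p
  have hx := mem_chart_source E x
  have hy : α.base x ∈ (chartAt E y).source := mem_chart_source E y
  have hq : α.baseRep x y p = extChartAt 𝓘(ℝ, E) y y := α.baseRep_apply hx
  have hA : α.linRep x y p = jetRep x y (α.toFun x) := α.linRep_apply hx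
  -- `α` need not be the bisection that witnesses affinity of `j`; only the actions are equal. The
  -- two chart formulas for this action are compared on the test elements with coordinates (v, d,
  -- 0).
  have hjet : ∀ d v : E, jetRep x y (α.toFun x) d = fderiv ℝ (α.baseRep x y) p d ∧
      affineForm cov x y p (extChartAt 𝓘(ℝ, E) y y) (jetRep x y (α.toFun x)) d v +
        jetRep x y (α.toFun x) 0 = fderiv ℝ (α.linRep x y) p d v + α.linRep x y p 0 := by
    intro d v
    have h1 := hj.chart2_act (y := y) hx hy ⟨mk2 x v d 0, rfl⟩
    have h2 := α.chart2_jetAct hx hy ⟨mk2 x v d 0, rfl⟩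
    rw [hjα, h2, chart2_mk2] at h1
    exact ⟨(congrArg (fun z => z.2.1) h1).symm, (congrArg (fun z => z.2.2) h1).symm⟩
  refine ⟨fun d => ?_, fun d v => ?_⟩
  · rw [hA]; exact ((hjet d 0).1).symm
  · have := (hjet d v).2
    rw [map_zero, map_zero, add_zero, add_zero] at this
    rw [hA, hq, this]

/-- The action of `S ∘ α` in charts. -/
theorem eventually_chart2_act {x₀ x y : M} {α : LocBis1 E x₀} {β : ∀ x' : M, Jet11 E x'}
    {𝒳₀ : T2 E M} (hd : 𝒳₀.proj.proj ∈ α.dom) (hx : 𝒳₀.proj.proj ∈ (chartAt E x).source)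
    (hy : α.base 𝒳₀.proj.proj ∈ (chartAt E y).source)
    (hβ : ∀ᶠ x' in 𝓝 𝒳₀.proj.proj, IsAffineExt cov (α.toFun x') (β x')) :
    ∀ᶠ 𝒳 in 𝓝 𝒳₀, chart2 y ((β 𝒳.proj.proj).act ⟨𝒳, rfl⟩) =
      affineAct cov x y (α.baseRep x y) (α.linRep x y) (chart2 x 𝒳) := by
  have hc2 : ContinuousAt (fun 𝒳 : T2 E M => 𝒳.proj.proj) 𝒳₀ :=
    ((FiberBundle.continuous_proj E _).comp
      (FiberBundle.continuous_proj (E × E) _)).continuousAt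
  filter_upwards [hc2.eventually hβ, hc2.eventually (α.eventually_mem hd hx hy)] with 𝒳 h3 h4
  rw [h3.chart2_act h4.2.1 h4.2.2 ⟨𝒳, rfl⟩]
  dsimp only
  rw [affineAct, chart2_fst_fst, α.baseRep_apply h4.2.1, α.linRep_apply h4.2.1]
  rfl

/-- The action of `𝕊(ξ)` in the preferred charts. -/
theorem IsAffineExt3.act_mk3 [T2Space M]
    (hcov : CovariantDerivative.ContMDiffCovariantDerivative cov ∞)
    {x : M} {ξ : Jet1 E x} {J : Jet111 E x} (hJ : IsAffineExt3 cov ξ J) (a b c d e f g : E) :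
    J.act ⟨mk3 x a b c d e f g, rfl⟩ =
      let A := jetRep x ξ.tgt ξ
      let p := extChartAt 𝓘(ℝ, E) x x
      let q := extChartAt 𝓘(ℝ, E) ξ.tgt ξ.tgt
      let S := affineForm cov x ξ.tgt p q A
      mk3 ξ.tgt (A a) (A b) (S b a + A c) (A d) (S d a + A e) (S d b + A f)
        (affineForm2 cov x ξ.tgt p q A a b c d e f g) := by
  obtain ⟨α, rfl, ⟨j, hj, hjα⟩, β, hβ, hJβ⟩ := hJ
  have hx := mem_chart_source E x
  have hy : α.base x ∈ (chartAt E (α.base x)).source := mem_chart_source E (α.base x)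
  obtain ⟨h1, h2⟩ := hj.fderiv_eq hjα
  have hdb := (α.contDiffAt_baseRep α.mem_dom hx hy).differentiableAt (by simp)
  have hdl := (α.contDiffAt_linRep α.mem_dom hx hy).differentiableAt (by simp)
  have hGx := (contDiffAt_christoffel cov hcov hx).differentiableAt (by simp)
  have hGy := (contDiffAt_christoffel cov hcov hy).differentiableAt (by simp)
  rw [← α.baseRep_apply hx] at hGy
  obtain ⟨L, hL, hL'⟩ := hasFDerivAt_affineAct (a := a) (b := b) (c := c) hdb hdl hGx hGy h1 h2
  have hev := eventually_chart2_act (β := β.toFun) (𝒳₀ := mk2 x a b c) α.mem_dom hx hy hβ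
  have htgt : (β.act (mk2 x a b c)).proj.proj = α.base x :=
    hβ.self_of_nhds.tgt_act ⟨mk2 x a b c, rfl⟩
  have h8 : (J.act ⟨mk3 x a b c d e f g, rfl⟩).proj.proj.proj = α.base x := by
    rw [hJβ]; exact htgt
  have hyt : (β.act (mk2 x a b c)).proj.proj ∈ (chartAt E (α.base x)).source := by
    rw [htgt]; exact hy
  rw [← chart2_mk2] at hL
  have h6 := tchart_tangentMap (X := mk3 x a b c d e f g) (n₀ := (⟨⟨x, 0⟩, 0⟩ : T2 E M))
    (n₀' := (⟨⟨α.base x, 0⟩, 0⟩ : T2 E M))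
    ((β.contMDiffAt_act β.mem_dom).mdifferentiableAt (by simp))
    ((mem_chart2 rfl).2 hx) ((mem_chart2 rfl).2 hyt) hev hL
  have h7 : chart3 (α.base x) (J.act ⟨mk3 x a b c d e f g, rfl⟩) =
      (affineAct cov x (α.base x) (α.baseRep x (α.base x)) (α.linRep x (α.base x))
        (chart2 x (mk2 x a b c)), L (chart3 x (mk3 x a b c d e f g)).2) := by
    rw [hJβ]; exact h6
  refine chart3_injective (x := α.base x) (by rw [h8]; exact hy) (by exact hy) ?_
  have hq : α.baseRep x (α.base x) (extChartAt 𝓘(ℝ, E) x x) = _ := α.baseRep_apply hx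
  have hA : α.linRep x (α.base x) (extChartAt 𝓘(ℝ, E) x x) = _ := α.linRep_apply hx
  rw [h7, chart3_mk3, hL', chart2_mk2, affineAct, hq, hA]
  exact (chart3_mk3 _ _ _ _ _ _ _ _).symm

theorem IsAffineExt3.unique [T2Space M]
    (hcov : CovariantDerivative.ContMDiffCovariantDerivative cov ∞)
    {x : M} {ξ : Jet1 E x} {J J' : Jet111 E x} (hJ : IsAffineExt3 cov ξ J)
    (hJ' : IsAffineExt3 cov ξ J') : J = J' := by
  ext1
  funext 𝔛
  obtain ⟨⟨⟨⟨y, a⟩, ⟨b, c⟩⟩, ⟨⟨d, e⟩, ⟨f, g⟩⟩⟩, rfl⟩ := 𝔛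
  exact (hJ.act_mk3 hcov a b c d e f g).trans (hJ'.act_mk3 hcov a b c d e f g).symm

end Third

/-! ### The defect of κ-invariance and the curvature -/

section Curvature

variable {E : Type*} [NormedAddCommGroup E] [NormedSpace ℝ E]
  {M : Type*} [TopologicalSpace M] [ChartedSpace E M] [IsManifold 𝓘(ℝ, E) ∞ M]

theorem kappa_mk3 (y : M) (a b c d e f g : E) :
    kappa (mk3 y a b c d e f g) = mk3 y a d e b c f g := rfl

/-- Each vertical lift puts a zero in front, so after two lifts only the last coordinate is nonzero.
-/
theorem translate_mk3 (y : M) (a b c d e f g : E) (V : TangentSpace 𝓘(ℝ, E) y) :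
    translate (mk3 y a b c d e f g) V = mk3 y a b c d e f (g + (show E from V)) := by
  have h1 : vlift (I := 𝓘(ℝ, E).tangent) (mk3 y a b c d e f g).proj
      (vlift (I := 𝓘(ℝ, E)) (mk3 y a b c d e f g).proj.proj V) =
      (show (E × E) × (E × E) from ((0, 0), (0, (show E from V)))) := by
    refine (vlift_eq (I := 𝓘(ℝ, E).tangent) _ _).trans ?_
    exact congrArg (fun w : E × E => (((0, 0), w) : (E × E) × (E × E)))
      (vlift_eq (I := 𝓘(ℝ, E)) (mk3 y a b c d e f g).proj.proj V)
  have h2 : ((((d, e), (f, g)) : (E × E) × (E × E)) + ((0, 0), (0, (show E from V)))) =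
      ((d, e), (f, g + (show E from V))) :=
    Prod.ext (add_zero (d, e)) (Prod.ext (add_zero f) rfl)
  refine (congrArg (fun w : (E × E) × (E × E) =>
    (⟨mk2 y a b c, (((d, e), (f, g)) : (E × E) × (E × E)) + w⟩ : T3 E M)) h1).trans ?_
  exact congrArg (fun w : (E × E) × (E × E) => (⟨mk2 y a b c, w⟩ : T3 E M)) h2

theorem isDiff_mk3 {y : M} {a b c d e f g g' : E} {V : TangentSpace 𝓘(ℝ, E) y}
    (h : (show E from V) = g - g') :
    IsDiff (mk3 y a b c d e f g) (mk3 y a b c d e f g') ⟨y, V⟩ := by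
  refine ⟨rfl, ?_⟩
  refine Eq.trans ?_ (translate_mk3 y a b c d e f g' V).symm
  rw [h, add_sub_cancel]

variable [FiniteDimensional ℝ E]
  (cov : CovariantDerivative 𝓘(ℝ, E) E (TangentSpace 𝓘(ℝ, E) : M → Type _))

/-- The coordinate expression of the curvature. -/
def curvForm (x : M) (p u v w : E) : E :=
  let G := christoffel cov x
  fderiv ℝ G p u v w + G p u (G p v w) - (fderiv ℝ G p v u w + G p v (G p u w))

variable {cov}

/-- The terms in c, e, f, g are unchanged by the exchange of (b, c) and (d, e), and the mixed terms
Γ(Ad, A Γ(b, a)) and Γ(Ab, A Γ(d, a)) cancel. Symmetry `hS` is needed for one term only, Γ(S(d, b),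
Aa). What survives is DΓ + ΓΓ, antisymmetrized in d and b, at source and target. -/
theorem affineForm2_sub {x y : M} {p q : E} {A : E →L[ℝ] E} {b d : E}
    (hS : affineForm cov x y p q A d b = affineForm cov x y p q A b d) (a c e f g : E) :
    affineForm2 cov x y p q A a b c d e f g - affineForm2 cov x y p q A a d e b c f g =
      A (curvForm cov x p d b a) - curvForm cov y q (A d) (A b) (A a) := by
  simp only [affineForm2, hS, curvForm, map_add, map_sub, add_apply]
  simp only [affineForm, map_sub]
  abel

/-- In coordinates T(d, b) = Γ(d, b) − Γ(b, d), so S(d, b) − S(b, d) = A T(d, b) − T(Ad, Ab). -/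
theorem PreservesTorsion.affineForm_comm {x : M} {ξ : Jet1 E x} (hξ : PreservesTorsion cov ξ)
    (d b : E) :
    let S := affineForm cov x ξ.tgt (extChartAt 𝓘(ℝ, E) x x) (extChartAt 𝓘(ℝ, E) ξ.tgt ξ.tgt)
      (jetRep x ξ.tgt ξ)
    S d b = S b d := by
  intro S
  have h' := (jetRep_self ξ _).trans ((congrArg ξ.map (torsion_eq cov x d b)).symm.trans
    ((hξ d b).trans (torsion_eq cov ξ.tgt (ξ.map d) (ξ.map b))))
  rw [← jetRep_self ξ d, ← jetRep_self ξ b] at h'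
  dsimp only at h'
  rw [map_sub] at h'
  simp only [S, affineForm]
  rw [sub_eq_sub_iff_add_eq_add] at h' ⊢
  rw [h']; abel

variable [T2Space M]

theorem jetRep_curvForm (hcov : CovariantDerivative.ContMDiffCovariantDerivative cov ∞) {x : M}
    (ξ : Jet1 E x) (u v w : E) :
    let A := jetRep x ξ.tgt ξ
    A (curvForm cov x (extChartAt 𝓘(ℝ, E) x x) u v w) -
      curvForm cov ξ.tgt (extChartAt 𝓘(ℝ, E) ξ.tgt ξ.tgt) (A u) (A v) (A w) =
    (show E from ξ.map (curvature cov x u v w) -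
      curvature cov ξ.tgt (ξ.map u) (ξ.map v) (ξ.map w)) := by
  intro A
  have h1 := curvature_eq cov hcov x u v w
  have h2 := curvature_eq cov hcov ξ.tgt (ξ.map u) (ξ.map v) (ξ.map w)
  have h3 : ξ.map (curvature cov x u v w) = A (curvForm cov x (extChartAt 𝓘(ℝ, E) x x) u v w) := by
    rw [h1]; exact (jetRep_self ξ _).symm
  have h4 : curvature cov ξ.tgt (ξ.map u) (ξ.map v) (ξ.map w) =
      curvForm cov ξ.tgt (extChartAt 𝓘(ℝ, E) ξ.tgt ξ.tgt) (A u) (A v) (A w) := by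
    rw [h2, ← jetRep_self ξ u, ← jetRep_self ξ v, ← jetRep_self ξ w]; rfl
  rw [h3, h4]; rfl

variable {x : M} {ξ : Jet1 E x} {J : Jet111 E x}

/-- The torsion hypothesis enters twice: it makes the penultimate coordinates agree, so that the
difference is defined, and it reduces the difference to curvature. The defect involves only a, b and
d. -/
theorem IsAffineExt3.isDiff_mk3 (hcov : CovariantDerivative.ContMDiffCovariantDerivative cov ∞)
    (hJ : IsAffineExt3 cov ξ J) (hξ : PreservesTorsion cov ξ) (a b c d e f g : E) :
    IsDiff (J.act ⟨mk3 x a b c d e f g, rfl⟩) (J.kappaAct ⟨mk3 x a b c d e f g, rfl⟩)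
      ⟨ξ.tgt, ξ.map (curvature cov x d b a) -
        curvature cov ξ.tgt (ξ.map d) (ξ.map b) (ξ.map a)⟩ := by
  have h1 := hJ.act_mk3 hcov a b c d e f g
  have h2 : J.kappaAct ⟨mk3 x a b c d e f g, rfl⟩ = _ :=
    congrArg kappa (hJ.act_mk3 hcov a d e b c f g)
  dsimp only at h1 h2
  rw [h1, h2, kappa_mk3, hξ.affineForm_comm b d]
  refine AffineJets.isDiff_mk3 ?_
  rw [affineForm2_sub (hξ.affineForm_comm d b)]
  exact (jetRep_curvForm hcov ξ d b a).symm

theorem IsAffineExt3.isDiff (hcov : CovariantDerivative.ContMDiffCovariantDerivative cov ∞)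
    (hJ : IsAffineExt3 cov ξ J) (hξ : PreservesTorsion cov ξ) {𝔛 : T3At E x}
    {u v w : TangentSpace 𝓘(ℝ, E) x} (hw : 𝔛.1.proj.proj = ⟨x, w⟩)
    (hv : (show E × E from 𝔛.1.proj.2).1 = v)
    (hu : (show (E × E) × (E × E) from 𝔛.1.2).1.1 = u) :
    IsDiff (J.act 𝔛) (J.kappaAct 𝔛) ⟨ξ.tgt, ξ.map (curvature cov x u v w) -
        curvature cov ξ.tgt (ξ.map u) (ξ.map v) (ξ.map w)⟩ := by
  obtain ⟨⟨⟨⟨y, a⟩, ⟨b, c⟩⟩, ⟨⟨d, e⟩, ⟨f, g⟩⟩⟩, hy⟩ := 𝔛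
  obtain rfl : y = x := hy
  obtain rfl : a = w := by
    have := hw
    simpa using this
  subst hv hu
  exact hJ.isDiff_mk3 hcov hξ a b c d e f g

-- Translation by `V` adds `V` to the last coordinate, so the action is free.
omit [FiniteDimensional ℝ E] [T2Space M] in
theorem IsDiff.eq_iff {𝔛 𝔜 : T3 E M} {V : T1 E M} (h : IsDiff 𝔛 𝔜 V) :
    𝔜 = 𝔛 ↔ (show E from V.2) = 0 := by
  obtain ⟨⟨⟨y, a⟩, ⟨b, c⟩⟩, ⟨⟨d, e⟩, ⟨f, g⟩⟩⟩ := 𝔜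
  obtain ⟨z, V⟩ := V
  obtain ⟨hz, h⟩ := h
  obtain rfl : z = y := hz
  have h' := h.trans (translate_mk3 (E := E) z a b c d e f g V)
  rw [h']
  constructor
  · intro h2
    have h3 : ((((d, e), (f, g)) : (E × E) × (E × E)) = ((d, e), (f, g + (show E from V)))) :=
      eq_of_heq (TotalSpace.mk.inj h2).2
    have h4 : g = g + (show E from V) := congrArg (fun w => w.2.2) h3
    exact add_eq_left (a := (g : E)).1 h4.symm
  · intro h2
    change (show E from V) = 0 at h2
    exact congrArg (fun v : E => mk3 (E := E) z a b c d e f v)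
      ((congrArg (g + ·) h2).trans (add_zero g)).symm

/-- `𝕊(ξ)` is `κ`-invariant if and only if `ξ` preserves the curvature. -/
theorem IsAffineExt3.kappa_invariant_iff
    (hcov : CovariantDerivative.ContMDiffCovariantDerivative cov ∞)
    (hJ : IsAffineExt3 cov ξ J) (hξ : PreservesTorsion cov ξ) :
    (∀ 𝔛 : T3At E x, J.kappaAct 𝔛 = J.act 𝔛) ↔ PreservesCurvature cov ξ := by
  constructor
  · intro h u v w
    -- Every triple occurs as the coordinates (d, b, a) of an element of T³M; the coordinates that
    -- do not affect the defect are set to zero.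
    have h1 := (hJ.isDiff_mk3 hcov hξ w v 0 u 0 0 0).eq_iff.1 (h _)
    exact sub_eq_zero.1 h1
  · rintro h ⟨⟨⟨⟨y, a⟩, ⟨b, c⟩⟩, ⟨⟨d, e⟩, ⟨f, g⟩⟩⟩, rfl⟩
    refine (hJ.isDiff_mk3 hcov hξ a b c d e f g).eq_iff.2 ?_
    exact sub_eq_zero.2 (h d b a)

-- Two projection identities: p ∘ W = id shows that the base part of W_* v is v, and p ∘ Z_* = Z ∘ p
-- shows that the base part of Z_** w is Z_*(p_* w). With w = Y_* X, the latter is Z_* X, whose base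
-- part is X.
omit [FiniteDimensional ℝ E] [T2Space M] in
theorem thirdTangent_coords {X Y Z : Π x : M, TangentSpace 𝓘(ℝ, E) x}
    (hY : SmoothField Y) (hZ : SmoothField Z) (x : M) :
    (show E × E from (thirdTangent X Y Z x).1.proj.2).1 = Y x ∧
      (show (E × E) × (E × E) from (thirdTangent X Y Z x).1.2).1.1 = X x := by
  have hZ' : ∀ x, MDifferentiableAt 𝓘(ℝ, E) 𝓘(ℝ, E).tangent (toSection Z) x := fun x =>
    hZ.contMDiffAt.mdifferentiableAt (by simp)
  have hY' : ∀ x, MDifferentiableAt 𝓘(ℝ, E) 𝓘(ℝ, E).tangent (toSection Y) x := fun x =>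
    hY.contMDiffAt.mdifferentiableAt (by simp)
  have key : ∀ {W : Π x : M, TangentSpace 𝓘(ℝ, E) x}
      (_ : ∀ x, MDifferentiableAt 𝓘(ℝ, E) 𝓘(ℝ, E).tangent (toSection W) x) (x : M)
      (v : TangentSpace 𝓘(ℝ, E) x),
      (show E × E from mfderiv 𝓘(ℝ, E) 𝓘(ℝ, E).tangent (toSection W) x v).1 = v := by
    intro W hW x v
    have h1 := mfderiv_comp x (g := fun X : T1 E M => X.proj)
      (mdifferentiableAt_proj (TangentSpace 𝓘(ℝ, E))) (hW x)
    have h2 := congrArg (fun A => A v) h1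
    have h3 : mfderiv 𝓘(ℝ, E) 𝓘(ℝ, E) (fun x : M => x) x v = v := by
      exact congrArg (fun A => A v) (mfderiv_id (I := 𝓘(ℝ, E)) (x := x))
    exact (mfderiv_proj (I := 𝓘(ℝ, E)) (toSection W x)
      (mfderiv 𝓘(ℝ, E) 𝓘(ℝ, E).tangent (toSection W) x v)).symm.trans (h2.symm.trans h3)
  refine ⟨key hZ' x (Y x), ?_⟩
  let T : T1 E M → T2 E M := tangentMap 𝓘(ℝ, E) 𝓘(ℝ, E).tangent (toSection Z)
  let U : T1 E M := toSection Y x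
  have hT : MDifferentiableAt 𝓘(ℝ, E).tangent 𝓘(ℝ, E).tangent.tangent T U :=
    (ContMDiff.contMDiff_tangentMap (n := ∞) hZ (m := ∞) (by simp)).contMDiffAt.mdifferentiableAt
      (by simp)
  let w : TangentSpace 𝓘(ℝ, E).tangent U := mfderiv 𝓘(ℝ, E) 𝓘(ℝ, E).tangent (toSection Y) x (X x)
  have hp := mfderiv_proj (I := 𝓘(ℝ, E).tangent) (T U)
    (mfderiv 𝓘(ℝ, E).tangent 𝓘(ℝ, E).tangent.tangent T U w)
  have h1 := mfderiv_comp U (g := fun X : T2 E M => X.proj)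
    (mdifferentiableAt_proj (TangentSpace 𝓘(ℝ, E).tangent)) hT
  have h2 := mfderiv_comp U (hZ' x) (f := fun X : T1 E M => X.proj)
    (mdifferentiableAt_proj (TangentSpace 𝓘(ℝ, E)))
  have h3 := congrArg (fun A => A w) (h1.symm.trans h2)
  have h4 := hp.symm.trans h3
  have h5 := mfderiv_proj (I := 𝓘(ℝ, E)) U w
  have h6 : (show E × E from w).1 = X x := key hY' x (X x)
  have h7 : mfderiv 𝓘(ℝ, E).tangent 𝓘(ℝ, E) (fun X : T1 E M => X.proj) U w = X x := h5.trans h6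
  have h8 := key hZ' x (X x)
  have h9 := congrArg (fun v => mfderiv 𝓘(ℝ, E) 𝓘(ℝ, E).tangent (toSection Z) x v) h7
  exact (congrArg Prod.fst (h4.trans h9)).trans h8

/-- The defect of `κ`-invariance of `𝕊(ξ)`. -/
theorem IsAffineExt3.isDiff_thirdTangent
    (hcov : CovariantDerivative.ContMDiffCovariantDerivative cov ∞)
    (hJ : IsAffineExt3 cov ξ J) (hξ : PreservesTorsion cov ξ)
    {X Y Z : Π x : M, TangentSpace 𝓘(ℝ, E) x} (hY : SmoothField Y) (hZ : SmoothField Z) :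
    IsDiff (J.act (thirdTangent X Y Z x)) (J.kappaAct (thirdTangent X Y Z x))
      ⟨ξ.tgt, ξ.map (curvature cov x (X x) (Y x) (Z x)) -
        curvature cov ξ.tgt (ξ.map (X x)) (ξ.map (Y x)) (ξ.map (Z x))⟩ :=
  hJ.isDiff hcov hξ rfl (thirdTangent_coords hY hZ x).1 (thirdTangent_coords hY hZ x).2

omit [T2Space M] in
theorem curvForm_smul (p : E) (a : ℝ) (u v w : E) :
    curvForm cov x p (a • u) (a • v) (a • w) = a ^ 3 • curvForm cov x p u v w := by
  simp only [curvForm]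
  generalize christoffel cov x p = B
  generalize fderiv ℝ (christoffel cov x) p = T
  have hT : ∀ u v w : E, T (a • u) (a • v) (a • w) = a ^ 3 • T u v w := fun u v w => by
    rw [map_smul (T (a • u) (a • v)), map_smul (T (a • u)), T.map_smul a u, smul_apply, smul_apply,
      smul_apply]
    module
  have hB : ∀ u v : E, ∀ r s : ℝ, B (r • u) (s • v) = (r * s) • B u v := fun u v r s => by
    rw [map_smul (B (r • u)), map_smul B, smul_apply, smul_smul, mul_comm]
  simp only [hT, hB]
  module

theorem curvature_smul (hcov : CovariantDerivative.ContMDiffCovariantDerivative cov ∞) (a : ℝ)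
    (u v w : TangentSpace 𝓘(ℝ, E) x) :
    curvature cov x (a • u) (a • v) (a • w) = a ^ 3 • curvature cov x u v w :=
  (curvature_eq cov hcov x (a • u) (a • v) (a • w)).trans
    ((curvForm_smul (cov := cov) (extChartAt 𝓘(ℝ, E) x x) a u v w).trans
      (congrArg (fun z : TangentSpace 𝓘(ℝ, E) x => a ^ 3 • z) (curvature_eq cov hcov x u v w)).symm)

omit [T2Space M] in
theorem preservesTorsion_of_torsion_eq_zero (h : cov.torsion = 0) (ξ : Jet1 E x) :
    PreservesTorsion cov ξ := by
  intro u v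
  rw [h]
  exact map_zero ξ.map

/-- The curvature of a torsion-free connection in terms of the affine extension of a homothety. -/
theorem IsAffineExt3.curvature_eq_of_homothety
    (hcov : CovariantDerivative.ContMDiffCovariantDerivative cov ∞) (h0 : cov.torsion = 0)
    {a : ℝ} (ha : a ≠ 0) (h1 : a ≠ 1) (h2 : a ≠ -1)
    (hJ : IsAffineExt3 cov (homothety E x a ha) J)
    {X Y Z : Π x : M, TangentSpace 𝓘(ℝ, E) x} (hY : SmoothField Y) (hZ : SmoothField Z) :
    ∃ V : TangentSpace 𝓘(ℝ, E) x,
      IsDiff (J.act (thirdTangent X Y Z x)) (J.kappaAct (thirdTangent X Y Z x)) ⟨x, V⟩ ∧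
      curvature cov x (X x) (Y x) (Z x) = (1 / (a * (1 - a ^ 2))) • V := by
  refine ⟨_, hJ.isDiff_thirdTangent hcov (preservesTorsion_of_torsion_eq_zero h0 _) hY hZ, ?_⟩
  have h3 : a * (1 - a ^ 2) ≠ 0 := by
    refine mul_ne_zero ha fun h => ?_
    have : (1 - a) * (1 + a) = 0 := by linear_combination h
    rcases mul_eq_zero.1 this with h | h
    · exact h1 (by linarith)
    · exact h2 (by linarith)
  -- The homothety multiplies the transported curvature by a and the curvature of the images by a³,
  -- by trilinearity.
  have h4 : a • curvature cov x (X x) (Y x) (Z x) -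
      curvature cov x (a • X x) (a • Y x) (a • Z x) =
        (a * (1 - a ^ 2)) • curvature cov x (X x) (Y x) (Z x) := by
    rw [curvature_smul hcov]
    module
  refine Eq.trans ?_
    (congrArg (fun v : TangentSpace 𝓘(ℝ, E) x => (1 / (a * (1 - a ^ 2))) • v) h4).symm
  rw [smul_smul, one_div_mul_cancel h3, one_smul]

end Curvature

/-! ### Existence of S(ξ) -/

section Existence

variable {E : Type*} [NormedAddCommGroup E] [NormedSpace ℝ E]
  {M : Type*} [TopologicalSpace M] [ChartedSpace E M] [IsManifold 𝓘(ℝ, E) ∞ M]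

/-- The fibre coordinate `fchart` as an isomorphism. -/
def fchartEquiv {x x' : M} (h : x' ∈ (chartAt E x).source) : TangentSpace 𝓘(ℝ, E) x' ≃L[ℝ] E :=
  ContinuousLinearEquiv.equivOfInverse (fchart 𝓘(ℝ, E) x x') (fsymm 𝓘(ℝ, E) x x')
    (fsymm_fchart h) (fchart_fsymm h)

theorem Jet1.ext_jetRep {x y x' : M} {ξ ξ' : Jet1 E x'} (hx : x' ∈ (chartAt E x).source)
    (hy : ξ.tgt ∈ (chartAt E y).source) (ht : ξ.tgt = ξ'.tgt)
    (h : jetRep x y ξ = jetRep x y ξ') : ξ = ξ' := by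
  obtain ⟨t, m⟩ := ξ
  obtain ⟨t', m'⟩ := ξ'
  obtain rfl : t = t' := ht
  congr 1
  ext v
  refine fchart_injective (I := 𝓘(ℝ, E)) (n₀ := y) hy ?_
  exact (jetRep_fchart hx ⟨t, m⟩ v).symm.trans
    ((congrArg (fun A => A (fchart 𝓘(ℝ, E) x x' v)) h).trans (jetRep_fchart hx ⟨t, m'⟩ v))

/-- A preferred chart as a partial diffeomorphism. -/
def chartDiffeo (x : M) : PartialDiffeomorph 𝓘(ℝ, E) 𝓘(ℝ, E) M E ∞ where
  toPartialEquiv := extChartAt 𝓘(ℝ, E) x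
  open_source := isOpen_extChartAt_source x
  open_target := isOpen_extChartAt_target x
  contMDiffOn_toFun := by
    rw [extChartAt_source]; exact contMDiffOn_extChartAt
  contMDiffOn_invFun := contMDiffOn_extChartAt_symm x

open Classical in
/-- The family of 1-jets with base `Φ` and with linear part `e` in the preferred charts at `x` and
`y`. -/
def jetOfCharts (x y : M) (Φ : M → M) (e : E → E ≃L[ℝ] E) (x' : M) : Jet1 E x' where
  tgt := Φ x'
  map := if h : x' ∈ (chartAt E x).source ∧ Φ x' ∈ (chartAt E y).source then
      (fchartEquiv h.1).trans ((e (extChartAt 𝓘(ℝ, E) x x')).trans (fchartEquiv h.2).symm)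
    else ContinuousLinearEquiv.refl ℝ E

theorem jetRep_jetOfCharts {x y x' : M} {Φ : M → M} (e : E → E ≃L[ℝ] E)
    (hx : x' ∈ (chartAt E x).source) (hy : Φ x' ∈ (chartAt E y).source) :
    jetRep x y (jetOfCharts x y Φ e x') = e (extChartAt 𝓘(ℝ, E) x x') := by
  ext v
  have h1 : (jetOfCharts x y Φ e x').map = (fchartEquiv hx).trans
      ((e (extChartAt 𝓘(ℝ, E) x x')).trans (fchartEquiv hy).symm) := dif_pos ⟨hx, hy⟩
  have h2 : jetRep x y (jetOfCharts x y Φ e x') v =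
      fchart 𝓘(ℝ, E) y (Φ x') ((jetOfCharts x y Φ e x').map (fsymm 𝓘(ℝ, E) x x' v)) := rfl
  rw [h2, h1]
  refine (fchart_fsymm (I := 𝓘(ℝ, E)) (n₀ := y) hy _).trans ?_
  exact congrArg (e (extChartAt 𝓘(ℝ, E) x x')) (fchart_fsymm hx v)

/-- The local bisection of `B⁽¹⁾(Pair(M))` with base `Φ` and with linear part `e` in the preferred
charts at `x` and `y`. -/
def LocBis1.ofCharts (x y : M) (Φ : PartialDiffeomorph 𝓘(ℝ, E) 𝓘(ℝ, E) M M ∞) {s : Set E}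
    (hs : IsOpen s) (e : E → E ≃L[ℝ] E)
    (he : ∀ u ∈ s, ContDiffAt ℝ ∞ (fun u => (e u : E →L[ℝ] E)) u)
    (hx : Φ.source ⊆ (chartAt E x).source) (hy : ∀ x' ∈ Φ.source, Φ x' ∈ (chartAt E y).source)
    (hxΦ : x ∈ Φ.source) (hxs : extChartAt 𝓘(ℝ, E) x x ∈ s) : LocBis1 E x where
  toFun := jetOfCharts x y Φ e
  dom := Φ.source ∩ extChartAt 𝓘(ℝ, E) x ⁻¹' s
  isOpen_dom := ((continuousOn_extChartAt (I := 𝓘(ℝ, E)) x).mono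
    (by rwa [extChartAt_source])).isOpen_inter_preimage Φ.open_source hs
  mem_dom := ⟨hxΦ, hxs⟩
  smooth := by
    rintro X ⟨h1, h2⟩
    refine ContMDiffAt.contMDiffWithinAt ?_
    have hΦ : ContMDiffAt 𝓘(ℝ, E) 𝓘(ℝ, E) ∞ Φ X.proj :=
      Φ.contMDiffOn_toFun.contMDiffAt (Φ.open_source.mem_nhds h1)
    have hc := (FiberBundle.continuous_proj E (TangentSpace 𝓘(ℝ, E) : M → Type _)).continuousAt
      (x := X)
    have hev := hc.eventually (Φ.open_source.mem_nhds h1)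
    refine contMDiffAt_of_chart (I := 𝓘(ℝ, E).tangent) (I' := 𝓘(ℝ, E).tangent)
      (n₀ := (⟨x, 0⟩ : T1 E M)) (n₀' := (⟨y, 0⟩ : T1 E M))
      (g := fun z : E × E => (extChartAt 𝓘(ℝ, E) y (Φ ((extChartAt 𝓘(ℝ, E) x).symm z.1)),
        (e z.1 : E →L[ℝ] E) z.2)) ((mem_chart1 rfl).2 (hx h1)) ?_ ?_ ?_
    · filter_upwards [hev] with Y hY
      exact (mem_chart1 rfl).2 (hy _ hY)
    · filter_upwards [hev] with Y hY
      have e1 := tchart_apply (I := 𝓘(ℝ, E)) (n₀ := x) (X := Y) (hx hY)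
      have e2 := tchart_apply (I := 𝓘(ℝ, E)) (n₀ := y) (X := (⟨Φ Y.proj,
        (jetOfCharts x y Φ e Y.proj).map Y.2⟩ : T1 E M)) (hy _ hY)
      have e3 := (jetRep_fchart (y := y) (hx hY) (jetOfCharts x y Φ e Y.proj) Y.2).symm
      rw [jetRep_jetOfCharts e (hx hY) (hy _ hY)] at e3
      refine e2.trans ?_
      rw [show extChartAt 𝓘(ℝ, E).tangent (⟨x, 0⟩ : T1 E M) Y = _ from e1]
      rw [extChartAt_left_inv (hx hY)]
      exact Prod.ext rfl e3
    · have e1 : (extChartAt 𝓘(ℝ, E).tangent (⟨x, 0⟩ : T1 E M) X).1 =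
        extChartAt 𝓘(ℝ, E) x X.proj := rfl
      refine ContDiffAt.prodMk ?_ (ContDiffAt.clm_apply ?_ contDiffAt_snd)
      · refine ContDiffAt.comp (g := fun u => extChartAt 𝓘(ℝ, E) y
          (Φ ((extChartAt 𝓘(ℝ, E) x).symm u))) _ ?_ contDiffAt_fst
        exact contDiffAt_chart (hx h1) (hy _ h1) hΦ
      · exact ContDiffAt.comp (g := fun u => (e u : E →L[ℝ] E)) _ (he _ h2) contDiffAt_fst
  injOn := fun a ha b hb h => Φ.injOn ha.1 hb.1 h
  localDiffeo := fun x' => ⟨Φ, x'.2.1, fun _ _ => rfl⟩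


theorem LocBis1.semiholonomic_of_fderiv_baseRep {x₀ x y : M} {b : LocBis1 E x₀}
    (hx : x₀ ∈ (chartAt E x).source) (hy : b.base x₀ ∈ (chartAt E y).source)
    (hs : ∀ d, fderiv ℝ (b.baseRep x y) (extChartAt 𝓘(ℝ, E) x x₀) d = jetRep x y (b.toFun x₀) d) :
    b.Semiholonomic := by
  intro v
  have hB := ((b.contDiffAt_baseRep b.mem_dom hx hy).differentiableAt (by simp)).hasFDerivAt
  have h := tchart_tangentMap (X := (⟨x₀, v⟩ : T1 E M))
    ((b.contMDiffAt_base b.mem_dom).mdifferentiableAt (by simp)) hx hy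
    (by filter_upwards [eventually_chart hx] with m hm using (b.baseRep_apply hm).symm) hB
  have h2 := congrArg Prod.snd h
  rw [tchart_apply (by exact hy), tchart_apply (by exact hx)] at h2
  dsimp only [tangentMap] at h2
  rw [hs, jetRep_fchart hx] at h2
  exact fchart_injective hy h2

variable [FiniteDimensional ℝ E]
  {cov : CovariantDerivative 𝓘(ℝ, E) E (TangentSpace 𝓘(ℝ, E) : M → Type _)}

/-- A local bisection represents an affine jet if it does so in charts. -/
theorem LocBis1.preservesCov_of_fderiv_linRep {x₀ x y : M} {b : LocBis1 E x₀}
    (hx : x₀ ∈ (chartAt E x).source) (hy : b.base x₀ ∈ (chartAt E y).source)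
    (hs : ∀ d, fderiv ℝ (b.baseRep x y) (extChartAt 𝓘(ℝ, E) x x₀) d = jetRep x y (b.toFun x₀) d)
    (hl : ∀ d a, fderiv ℝ (b.linRep x y) (extChartAt 𝓘(ℝ, E) x x₀) d a =
      affineForm cov x y (extChartAt 𝓘(ℝ, E) x x₀) (extChartAt 𝓘(ℝ, E) y (b.base x₀))
        (jetRep x y (b.toFun x₀)) d a) : b.PreservesCov cov :=
  fun _ _ hY hW hYW u => (fderiv_linRep_iff hx hy hs hY hW hYW u).2 (hl _ _)

/-- The form `affineForm` as a continuous bilinear map. -/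
def affineFormL (cov : CovariantDerivative 𝓘(ℝ, E) E (TangentSpace 𝓘(ℝ, E) : M → Type _))
    (x y : M) (p q : E) (A : E →L[ℝ] E) : E →L[ℝ] E →L[ℝ] E :=
  (ContinuousLinearMap.compL ℝ E E E A).comp (christoffel cov x p) -
    (christoffel cov y q).bilinearComp A A

/-- The affine isomorphism with linear part `A` that takes `p` to `q`. -/
def affineDiffeo (p q : E) (A : E ≃L[ℝ] E) : Diffeomorph 𝓘(ℝ, E) 𝓘(ℝ, E) E E ∞ where
  toFun u := q + A (u - p)
  invFun v := p + A.symm (v - q)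
  left_inv u := by simp
  right_inv v := by simp
  contMDiff_toFun :=
    (contDiff_const.add (A.contDiff.comp (contDiff_id.sub contDiff_const))).contMDiff
  contMDiff_invFun :=
    (contDiff_const.add (A.symm.contDiff.comp (contDiff_id.sub contDiff_const))).contMDiff

variable (cov) in
/-- `S(ξ)` exists. -/
theorem exists_isAffineExt {x : M} (ξ : Jet1 E x) : ∃ b : LocBis1 E x,
    b.toFun x = ξ ∧ b.Semiholonomic ∧ b.PreservesCov cov := by
  classical
  have : CompleteSpace E := FiniteDimensional.complete ℝ E
  have hx := mem_chart_source E x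
  have hy := mem_chart_source E ξ.tgt
  let y := ξ.tgt
  let p := extChartAt 𝓘(ℝ, E) x x
  let q := extChartAt 𝓘(ℝ, E) y y
  let A : E ≃L[ℝ] E := (fchartEquiv hx).symm.trans (ξ.map.trans (fchartEquiv hy))
  have hA : jetRep x y ξ = A := rfl
  -- The simplest linear part with value A and derivative S at `p`. It is matched with the affine
  -- base map u ↦ q + A(u − p), whose derivative is A, as semi-holonomy requires.
  let B : E → E →L[ℝ] E := fun u => A + affineFormL cov x y p q A (u - p)
  have hBd : ContDiff ℝ ∞ B :=
    contDiff_const.add ((affineFormL cov x y p q A).contDiff.comp (contDiff_id.sub contDiff_const))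
  have hBp : B p = A := by simp [B]
  -- `B u` is invertible at u = p, and invertible operators form an open set, so `B` takes values in
  -- isomorphisms on a neighbourhood of p; `e` selects these isomorphisms and has an irrelevant
  -- value elsewhere.
  let s : Set E := B ⁻¹' Set.range ((↑) : (E ≃L[ℝ] E) → E →L[ℝ] E)
  have hs : IsOpen s := ContinuousLinearEquiv.isOpen.preimage hBd.continuous
  let e : E → E ≃L[ℝ] E := fun u => if h : u ∈ s then h.choose else ContinuousLinearEquiv.refl ℝ E
  have he : ∀ u ∈ s, (e u : E →L[ℝ] E) = B u := fun u hu => by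
    simp only [e, dif_pos hu]; exact hu.choose_spec
  have hps : p ∈ s := ⟨A, hBp.symm⟩
  let Φ : PartialDiffeomorph 𝓘(ℝ, E) 𝓘(ℝ, E) M M ∞ :=
    ((chartDiffeo x).trans (affineDiffeo p q A).toPartialDiffeomorph).trans (chartDiffeo y).symm
  have hΦs : ∀ x', x' ∈ Φ.source ↔ x' ∈ (chartAt E x).source ∧
      q + A (extChartAt 𝓘(ℝ, E) x x' - p) ∈ (extChartAt 𝓘(ℝ, E) y).target := by
    intro x'
    rw [← extChartAt_source 𝓘(ℝ, E) x]
    constructor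
    · rintro ⟨⟨h1, -⟩, h2⟩; exact ⟨h1, h2⟩
    · rintro ⟨h1, h2⟩; exact ⟨⟨h1, trivial⟩, h2⟩
  have hΦ : ∀ x', Φ x' = (extChartAt 𝓘(ℝ, E) y).symm (q + A (extChartAt 𝓘(ℝ, E) x x' - p)) :=
    fun _ => rfl
  have hΦy : ∀ x' ∈ Φ.source, Φ x' ∈ (chartAt E y).source := fun x' h =>
    symm_mem_source ((hΦs x').1 h).2
  have hp : q + A (p - p) = q := by simp
  have hxΦ : x ∈ Φ.source := (hΦs x).2 ⟨hx, by rw [hp]; exact mem_extChartAt_target y⟩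
  let b : LocBis1 E x := LocBis1.ofCharts x y Φ hs e
    (fun u hu => hBd.contDiffAt.congr_of_eventuallyEq
      (by filter_upwards [hs.mem_nhds hu] with v hv using he v hv))
    (fun x' h => ((hΦs x').1 h).1) hΦy hxΦ hps
  have hb0 : b.base x = y := by
    change Φ x = y
    rw [hΦ, hp]; exact extChartAt_to_inv y
  have hby : b.base x ∈ (chartAt E y).source := by rw [hb0]; exact hy
  have hbx : b.toFun x = ξ := by
    refine Jet1.ext_jetRep (y := y) hx hby hb0 ?_
    rw [hA, ← hBp, ← he p hps]
    exact jetRep_jetOfCharts e hx hby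
  have hev := eventually_symm (I := 𝓘(ℝ, E)) hx (Φ.open_source.mem_nhds hxΦ)
  have hev2 := eventually_target (I := 𝓘(ℝ, E)) hx
  have hbase : b.baseRep x y =ᶠ[𝓝 p] fun u => q + A (u - p) := by
    filter_upwards [hev, hev2] with u hu hu2
    have h1 := ((hΦs _).1 hu).2
    rw [(extChartAt 𝓘(ℝ, E) x).right_inv hu2] at h1
    have h2 : b.baseRep x y u = extChartAt 𝓘(ℝ, E) y (Φ ((extChartAt 𝓘(ℝ, E) x).symm u)) := rfl
    rw [h2, hΦ, (extChartAt 𝓘(ℝ, E) x).right_inv hu2, (extChartAt 𝓘(ℝ, E) y).right_inv h1]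
  have hlin : b.linRep x y =ᶠ[𝓝 p] B := by
    filter_upwards [hev, hev2, hs.mem_nhds hps] with u hu hu2 hus
    rw [← he u hus]
    conv_rhs => rw [← (extChartAt 𝓘(ℝ, E) x).right_inv hu2]
    exact jetRep_jetOfCharts e ((hΦs _).1 hu).1 (hΦy _ hu)
  have hD : HasFDerivAt (fun u => q + A (u - p)) (A : E →L[ℝ] E) p := by
    have := (A.hasFDerivAt.comp p ((hasFDerivAt_id p).sub_const p)).const_add q
    exact this
  have hDB : HasFDerivAt B (affineFormL cov x y p q A) p := by
    have := ((affineFormL cov x y p q A).hasFDerivAt.comp p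
      ((hasFDerivAt_id p).sub_const p)).const_add (A : E →L[ℝ] E)
    exact this
  have hs' : ∀ d, fderiv ℝ (b.baseRep x y) p d = jetRep x y (b.toFun x) d := fun d => by
    rw [hbase.fderiv_eq, hD.fderiv, hbx, hA]
  refine ⟨b, hbx, LocBis1.semiholonomic_of_fderiv_baseRep hx hby hs',
    LocBis1.preservesCov_of_fderiv_linRep hx hby hs' fun d a => ?_⟩
  rw [hlin.fderiv_eq, hDB.fderiv, hbx, hA, hb0]
  rfl

end Existence

/-! ### Existence of 𝕊(ξ) -/

section Existence3

variable {E : Type*} [NormedAddCommGroup E] [NormedSpace ℝ E] [FiniteDimensional ℝ E]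
  {M : Type*} [TopologicalSpace M] [ChartedSpace E M] [IsManifold 𝓘(ℝ, E) ∞ M]
  {cov : CovariantDerivative 𝓘(ℝ, E) E (TangentSpace 𝓘(ℝ, E) : M → Type _)}

theorem contDiffAt_affineAct {x y : M} {a₀ : E → E} {A : E → E →L[ℝ] E}
    {z : (E × E) × (E × E)} (ha₀ : ContDiffAt ℝ ∞ a₀ z.1.1) (hA : ContDiffAt ℝ ∞ A z.1.1)
    (hx : ContDiffAt ℝ ∞ (christoffel cov x) z.1.1)
    (hy : ContDiffAt ℝ ∞ (christoffel cov y) (a₀ z.1.1)) :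
    ContDiffAt ℝ ∞ (affineAct cov x y a₀ A) z := by
  have hu : ContDiffAt ℝ ∞ (fun z : (E × E) × (E × E) => z.1.1) z :=
    (contDiff_fst.comp contDiff_fst).contDiffAt
  have ha : ContDiffAt ℝ ∞ (fun z : (E × E) × (E × E) => z.1.2) z :=
    (contDiff_snd.comp contDiff_fst).contDiffAt
  have hb : ContDiffAt ℝ ∞ (fun z : (E × E) × (E × E) => z.2.1) z :=
    (contDiff_fst.comp contDiff_snd).contDiffAt
  have hc : ContDiffAt ℝ ∞ (fun z : (E × E) × (E × E) => z.2.2) z :=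
    (contDiff_snd.comp contDiff_snd).contDiffAt
  have ha₀' : ContDiffAt ℝ ∞ (fun z : (E × E) × (E × E) => a₀ z.1.1) z := ha₀.comp z hu
  have hA' : ContDiffAt ℝ ∞ (fun z : (E × E) × (E × E) => A z.1.1) z := hA.comp z hu
  have hx' : ContDiffAt ℝ ∞ (fun z : (E × E) × (E × E) => christoffel cov x z.1.1) z :=
    ContDiffAt.comp (g := christoffel cov x) z hx hu
  have hy' : ContDiffAt ℝ ∞ (fun z : (E × E) × (E × E) => christoffel cov y (a₀ z.1.1)) z :=
    ContDiffAt.comp (g := christoffel cov y) z hy ha₀'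
  have hAb := hA'.clm_apply hb
  have hAa := hA'.clm_apply ha
  have hS := (hA'.clm_apply ((hx'.clm_apply hb).clm_apply ha)).sub
    ((hy'.clm_apply hAb).clm_apply hAa)
  exact (ha₀'.prodMk hAa).prodMk (hAb.prodMk (hS.add (hA'.clm_apply hc)))

/-- The chart formula for S ∘ α is smooth in Γ, α and the point. The charts are those at the current
point and its image, because the domain of α need not lie in a single preferred chart. -/
theorem contMDiffAt_affineExt [T2Space M]
    (hcov : CovariantDerivative.ContMDiffCovariantDerivative cov ∞) {x₀ : M} {α : LocBis1 E x₀}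
    {β : ∀ x' : M, Jet11 E x'} (hβ : ∀ x', IsAffineExt cov (α.toFun x') (β x')) {𝒳 : T2 E M}
    (hd : 𝒳.proj.proj ∈ α.dom) :
    ContMDiffAt 𝓘(ℝ, E).tangent.tangent 𝓘(ℝ, E).tangent.tangent ∞
      (fun 𝒳 : T2 E M => (β 𝒳.proj.proj).act ⟨𝒳, rfl⟩) 𝒳 := by
  have hx := mem_chart_source E 𝒳.proj.proj
  have hy := mem_chart_source E (α.base 𝒳.proj.proj)
  have hc2 : ContinuousAt (fun 𝒳 : T2 E M => 𝒳.proj.proj) 𝒳 :=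
    ((FiberBundle.continuous_proj E _).comp
      (FiberBundle.continuous_proj (E × E) _)).continuousAt
  refine contMDiffAt_of_chart (I := 𝓘(ℝ, E).tangent.tangent) (I' := 𝓘(ℝ, E).tangent.tangent)
    (n₀ := (⟨⟨𝒳.proj.proj, 0⟩, 0⟩ : T2 E M)) (n₀' := (⟨⟨α.base 𝒳.proj.proj, 0⟩, 0⟩ : T2 E M))
    ((mem_chart2 rfl).2 hx) ?_
    (eventually_chart2_act hd hx hy (Filter.Eventually.of_forall hβ)) ?_
  · filter_upwards [hc2.eventually (α.eventually_mem hd hx hy)] with 𝒴 h𝒴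
    refine (mem_chart2 rfl).2 ?_
    rw [(hβ 𝒴.proj.proj).tgt_act]
    exact h𝒴.2.2
  · refine contDiffAt_affineAct (α.contDiffAt_baseRep hd hx hy) (α.contDiffAt_linRep hd hx hy)
      (contDiffAt_christoffel cov hcov hx) ?_
    have h : α.baseRep 𝒳.proj.proj (α.base 𝒳.proj.proj)
      (extChartAt 𝓘(ℝ, E) 𝒳.proj.proj 𝒳.proj.proj) = _ := α.baseRep_apply hx
    have h2 := contDiffAt_christoffel cov hcov hy
    rw [← h] at h2
    exact h2

/-- The local bisection `S ∘ α`. -/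
def LocBis11.ofAffineExt [T2Space M]
    (hcov : CovariantDerivative.ContMDiffCovariantDerivative cov ∞) {x : M} (α : LocBis1 E x)
    (β : ∀ x' : M, Jet11 E x') (hβ : ∀ x', IsAffineExt cov (α.toFun x') (β x')) :
    LocBis11 E x where
  toFun := β
  dom := α.dom
  isOpen_dom := α.isOpen_dom
  mem_dom := α.mem_dom
  smooth := fun _ h𝒳 => (contMDiffAt_affineExt hcov hβ h𝒳).contMDiffWithinAt
  injOn := by
    rw [funext fun x' => (hβ x').tgt_eq]; exact α.injOn
  localDiffeo := by
    rw [funext fun x' => (hβ x').tgt_eq]; exact α.localDiffeo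

variable (cov) in
theorem existsUnique_isAffineExt {x : M} (ξ : Jet1 E x) : ∃! j, IsAffineExt cov ξ j := by
  obtain ⟨b, hb⟩ := exists_isAffineExt cov ξ
  exact ⟨⟨b.jetAct, b, rfl⟩, ⟨b, rfl, hb⟩, fun j hj => hj.unique ⟨b, rfl, hb⟩⟩

theorem existsUnique_isAffineExt3 [T2Space M]
    (hcov : CovariantDerivative.ContMDiffCovariantDerivative cov ∞) {x : M} (ξ : Jet1 E x) :
    ∃! J, IsAffineExt3 cov ξ J := by
  obtain ⟨α, hα⟩ := exists_isAffineExt cov ξ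
  -- Pointwise choice causes no loss of regularity: the affine extension is unique, hence given by
  -- the smooth chart formula.
  choose β hβ using fun x' => (existsUnique_isAffineExt cov (α.toFun x')).exists
  let b := LocBis11.ofAffineExt hcov α β hβ
  have hJ : IsAffineExt3 cov ξ ⟨b.jetAct, b, rfl⟩ :=
    ⟨α, hα.1, ⟨⟨α.jetAct, α, rfl⟩, ⟨α, rfl, hα⟩, rfl⟩, b, Filter.Eventually.of_forall hβ, rfl⟩
  exact ⟨_, hJ, fun J hJ' => hJ'.unique hcov hJ⟩

end Existence3

end AffineJets

end

theorem proposition7p3 {E : Type*} [NormedAddCommGroup E] [NormedSpace ℝ E]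
    [FiniteDimensional ℝ E] {M : Type*} [TopologicalSpace M] [T2Space M] [ChartedSpace E M]
    [IsManifold 𝓘(ℝ, E) ∞ M]
    (cov : CovariantDerivative 𝓘(ℝ, E) E (TangentSpace 𝓘(ℝ, E) : M → Type _))
    (hcov : CovariantDerivative.ContMDiffCovariantDerivative cov ∞) :
    -- `S(ξ)` and `𝕊(ξ)` exist and are unique
    (∀ (x : M) (ξ : AffineJets.Jet1 E x),
      (∃! j, AffineJets.IsAffineExt cov ξ j) ∧ (∃! J, AffineJets.IsAffineExt3 cov ξ J)) ∧
    -- the formula for the defect of invariance of `J = 𝕊(ξ)`, and the criterion of invariance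
    (∀ (x : M) (ξ : AffineJets.Jet1 E x) (J : AffineJets.Jet111 E x),
      AffineJets.IsAffineExt3 cov ξ J → AffineJets.PreservesTorsion cov ξ →
      (∀ X Y Z : Π x : M, TangentSpace 𝓘(ℝ, E) x,
        AffineJets.SmoothField X → AffineJets.SmoothField Y → AffineJets.SmoothField Z →
        AffineJets.IsDiff (J.act (AffineJets.thirdTangent X Y Z x))
          (J.kappaAct (AffineJets.thirdTangent X Y Z x))
          ⟨ξ.tgt, ξ.map (AffineJets.curvature cov x (X x) (Y x) (Z x)) -
            AffineJets.curvature cov ξ.tgt (ξ.map (X x)) (ξ.map (Y x)) (ξ.map (Z x))⟩) ∧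
      ((∀ 𝔛 : AffineJets.T3At E x, J.kappaAct 𝔛 = J.act 𝔛) ↔
        AffineJets.PreservesCurvature cov ξ)) ∧
    -- the curvature of a torsion-free connection, from `J = 𝕊(m_a)`
    (cov.torsion = 0 → ∀ (x : M) (a : ℝ) (ha : a ≠ 0), a ≠ 1 → a ≠ -1 →
      ∀ J : AffineJets.Jet111 E x,
      AffineJets.IsAffineExt3 cov (AffineJets.homothety E x a ha) J →
      ∀ X Y Z : Π x : M, TangentSpace 𝓘(ℝ, E) x,
        AffineJets.SmoothField X → AffineJets.SmoothField Y → AffineJets.SmoothField Z →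
        ∃ V : TangentSpace 𝓘(ℝ, E) x,
          AffineJets.IsDiff (J.act (AffineJets.thirdTangent X Y Z x))
            (J.kappaAct (AffineJets.thirdTangent X Y Z x)) ⟨x, V⟩ ∧
          AffineJets.curvature cov x (X x) (Y x) (Z x) = (1 / (a * (1 - a ^ 2))) • V) := by
  exact ⟨fun x ξ => ⟨AffineJets.existsUnique_isAffineExt cov ξ,
      AffineJets.existsUnique_isAffineExt3 hcov ξ⟩,
    fun x ξ J hJ hξ => ⟨fun X Y Z _ hY hZ => hJ.isDiff_thirdTangent hcov hξ hY hZ,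
      hJ.kappa_invariant_iff hcov hξ⟩,
    fun h0 x a ha h1 h2 J hJ X Y Z _ hY hZ =>
      hJ.curvature_eq_of_homothety hcov h0 ha h1 h2 hY hZ⟩
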